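/- Let $B=(B(x))_{x\in\mathbb{R}}$ be a two-sided standard one-dimensional Brownian motion with $B(0)=0$, and let $V$ be the solution of the heat equation $\partial_t V=\partial_{xx}V$ on $(0,\infty)\times\mathbb{R}$ with initial condition $V(0,\cdot)=B$, that is, $$V(t,x)=\int_{\mathbb{R}}P_t(x-y)\,B(y)\,dy\quad(t>0,\ x\in\mathbb{R}),\qquad P_t(x)=\frac{e^{-x^2/(4t)}}{\sqrt{4\pi t}}.$$ Put $u=-\partial_xV$. Let $X=(X_t)_{t\ge0}$ be a real-valued process, defined on the same probability space as $B$, such that almost surely $X_0=0$, $t\mapsto X_t$ is continuous on $\mathbb{R}_+=[0,\infty)$, and $\partial_tX_t=u(t,X_t)$ for all $t>0$. Then, almost surely, $s\mapsto u(s,0)$ is integrable on $[0,\theta]$ for every $\theta\ge0$; the process $\left(\int_0^\theta u(s,0)\,ds\right)_{\theta\ge0}$ is Gaussian; and, when the space of continuous functions from $\mathbb{R}_+$ to $\mathbb{R}$ is endowed with the topology of uniform convergence on compact sets, $$\left(\frac{X_{\theta T}}{T^{3/4}}\right)_{\theta\ge0}\ \longrightarrow\ \left(\int_0^\theta u(s,0)\,ds\right)_{\theta\ge0}\quad\text{in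 law as } T\to0,\ T>0.$$ -/

import Mathlib

open MeasureTheory ProbabilityTheory Filter Topology
open scoped NNReal

namespace PassiveTracer

noncomputable section

/-- `B` is a two-sided Brownian motion `(B(x))_{x ∈ ℝ}` started at `0`: the processes
`(B(x))_{x ≥ 0}` and `(B(-x))_{x ≥ 0}` are two independent standard Brownian motions. -/
structure IsTwoSidedBrownian {Ω : Type*} [MeasurableSpace Ω] (B : ℝ → Ω → ℝ)
    (P : Measure Ω) : Prop where
  right : IsBrownianReal (fun (x : ℝ≥0) ω ↦ B (x : ℝ) ω) P
  left : IsBrownianReal (fun (x : ℝ≥0) ω ↦ B (-(x : ℝ)) ω) P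
  indep : IndepFun (fun ω (x : ℝ≥0) ↦ B (x : ℝ) ω) (fun ω (x : ℝ≥0) ↦ B (-(x : ℝ)) ω) P

/-- The kernel of the heat equation `∂ₜ V = ∂ₓₓ V` on the line. -/
def heatKernel (t x : ℝ) : ℝ :=
  Real.exp (-x ^ 2 / (4 * t)) / √(4 * Real.pi * t)

/-- The potential at time `t ≥ 0`: the solution of the heat equation started from `b`. -/
def potential (b : ℝ → ℝ) (t x : ℝ) : ℝ :=
  if t = 0 then b x else ∫ y : ℝ, heatKernel t (x - y) * b y

/-- The velocity field `u = -∂ₓ V`. -/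
def velocity (b : ℝ → ℝ) (t x : ℝ) : ℝ :=
  -deriv (fun z : ℝ ↦ potential b t z) x

/-- `X` is the passive particle in the environment generated by `B`: a real process on `ℝ₊`
whose paths almost surely start at `0`, are continuous on `ℝ₊`, and satisfy
`∂ₜ X_t = u(t, X_t)` for all `t > 0`. -/
structure IsPassiveParticle {Ω : Type*} [MeasurableSpace Ω] (B : ℝ → Ω → ℝ)
    (X : ℝ≥0 → Ω → ℝ) (P : Measure Ω) : Prop where
  aemeasurable : ∀ t : ℝ≥0, AEMeasurable (X t) P
  initial : ∀ᵐ ω ∂P, X 0 ω = 0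
  continuous : ∀ᵐ ω ∂P, Continuous fun t : ℝ≥0 ↦ X t ω
  hasDerivAt : ∀ᵐ ω ∂P, ∀ t : ℝ, 0 < t →
    HasDerivAt (fun s : ℝ ↦ X s.toNNReal ω)
      (velocity (fun x ↦ B x ω) t (X t.toNNReal ω)) t

/-- The integrated velocity at the origin, `∫₀^θ u(s, 0) ds`. -/
def integratedVelocity (b : ℝ → ℝ) (θ : ℝ≥0) : ℝ :=
  ∫ s in (0 : ℝ)..(θ : ℝ), velocity b s 0

/-- `C(ℝ≥0, ℝ)` carries the topology of uniform convergence on compact sets; it is given the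
corresponding Borel σ-algebra. -/
instance instMeasurableSpacePaths : MeasurableSpace C(ℝ≥0, ℝ) := borel _

instance instBorelSpacePaths : BorelSpace C(ℝ≥0, ℝ) := ⟨rfl⟩

open Classical in
/-- A continuous function on `ℝ₊` seen as an element of the path space. A function that is not
continuous (this occurs only on a null event for the processes considered) is sent to `0`. -/
def toPath (f : ℝ≥0 → ℝ) : C(ℝ≥0, ℝ) :=
  if h : Continuous f then ⟨f, h⟩ else 0

end

end PassiveTracer

/-! Put `c = √T` and rescale the environment to `B^c(y) = c^{-1/2} B(cy)`, again a two-sided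
Brownian motion. With `u^c` its velocity field, `Y_θ = X_{θT} / T^{3/4}` solves `Y' = u^c(s, √c Y)`
(`hasDerivAt_rescale`), where the coupling `√c = T^{1/4}` vanishes. So `Y` should be close to `∫₀^θ
u^c(s, 0) ds`, whose law is exactly that of the limit for every `T > 0`. It remains to show
closeness in probability, locally uniformly in time.

That comparison is deterministic. By `velocity_eq`, `u(s, x)` is `s^{-1/2}` times an average of `b(x
+ √s z)` against a Gaussian-tailed profile. Hence a modulus bound `|b(y + h) - b(y)| ≤ ρ (1 + y²)`
for `|h| ≤ r` makes `|u(s, x) - u(s, 0)|` at most a constant times `ρ s^{-1/2}` when `|x| ≤ r`,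
which is integrable at `0`. A first-exit argument (`abs_sub_integral_velocity_le`) closes the
estimate. The required bounds (`tame`) hold with probability close to one, uniformly in `T`, because
the law of `B^c` does not depend on `c`.

Gaussianity holds because the integrated velocity is linear in the environment: it is an almost sure
limit of finite linear combinations of values of `B`. -/

namespace PassiveTracer

/-! ### Path space: measurability, laws, and a criterion for convergence in law -/

section

/-- A map into the path space is measurable as soon as its evaluations are. -/
lemma measurable_path_of_eval {S : Type*} [MeasurableSpace S] {F : S → C(ℝ≥0, ℝ)}
    (hF : ∀ t, Measurable fun s ↦ F s t) : Measurable F := by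
  have key := borel_eq_generateFrom_of_subbasis (α := C(ℝ≥0, ℝ))
    (ContinuousMap.compactOpen_eq)
  have hm : instMeasurableSpacePaths = borel _ := rfl
  rw [hm, key]
  refine measurable_generateFrom ?_
  rintro _ ⟨K, hK, U, hU, rfl⟩
  obtain ⟨D, hDK, hDc, hDd⟩ :=
    (TopologicalSpace.IsSeparable.of_separableSpace K).exists_countable_dense_subset
  -- A compact image lies in `U` exactly when it keeps some distance `1 / (n + 1)` from the
  -- complement. This closed condition can be tested on a countable dense subset of `K`.
  let G : ℕ → Set ℝ := fun n ↦ {x | ∀ y ∈ Uᶜ, 1 / ((n : ℝ) + 1) ≤ dist x y}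
  have hGc : ∀ n, IsClosed (G n) := fun n ↦ by
    simp only [G, Set.ofPred_forall]
    exact isClosed_biInter fun y _ ↦ isClosed_le continuous_const (by fun_prop)
  have heq : F ⁻¹' {f | Set.MapsTo f K U} = ⋃ n, ⋂ t ∈ D, (fun s ↦ F s t) ⁻¹' G n := by
    ext s
    simp only [Set.mem_preimage, Set.mem_ofPred_eq, Set.mem_iUnion, Set.mem_iInter]
    constructor
    · intro h
      obtain ⟨δ, hδ, hsub⟩ := (hK.image (F s).continuous).exists_thickening_subset_open hU
        h.image_subset
      obtain ⟨n, hn⟩ := exists_nat_one_div_lt hδ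
      refine ⟨n, fun t ht y hy ↦ ?_⟩
      by_contra! hlt
      exact hy (hsub (Metric.mem_thickening_iff.2
        ⟨F s t, Set.mem_image_of_mem _ (hDK ht), by rw [dist_comm]; exact hlt.trans hn⟩))
    · rintro ⟨n, hn⟩ t ht
      have hcl : F s t ∈ G n := by
        have : closure D ⊆ F s ⁻¹' G n :=
          closure_minimal (fun t ht ↦ hn t ht) ((hGc n).preimage (F s).continuous)
        exact this (hDd ht)
      by_contra hU'
      have := hcl _ hU'
      rw [dist_self] at this
      have : (0 : ℝ) < 1 / ((n : ℝ) + 1) := by positivity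
      linarith
  rw [heq]
  exact .iUnion fun n ↦ .biInter hDc fun t _ ↦ hF t (hGc n).measurableSet

lemma measurable_path_eval (t : ℝ≥0) : Measurable fun f : C(ℝ≥0, ℝ) ↦ f t :=
  (continuous_eval_const t).measurable

lemma measurable_path_coe : Measurable fun (f : C(ℝ≥0, ℝ)) (t : ℝ≥0) ↦ f t :=
  measurable_pi_lambda _ measurable_path_eval

/-- Evaluations generate the Borel σ-algebra, so equality of laws and independence can be
transported from the product space `ℝ≥0 → ℝ`. -/
lemma comap_path_coe :
    MeasurableSpace.comap (fun (f : C(ℝ≥0, ℝ)) (t : ℝ≥0) ↦ f t) MeasurableSpace.pi =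
      instMeasurableSpacePaths := by
  refine le_antisymm measurable_path_coe.comap_le ?_
  have h : @Measurable _ _ (MeasurableSpace.comap (fun (f : C(ℝ≥0, ℝ)) (t : ℝ≥0) ↦ f t)
      MeasurableSpace.pi) instMeasurableSpacePaths id :=
    letI := MeasurableSpace.comap (fun (f : C(ℝ≥0, ℝ)) (t : ℝ≥0) ↦ f t) MeasurableSpace.pi
    measurable_path_of_eval fun t ↦
      (measurable_pi_apply t).comp (comap_measurable fun (f : C(ℝ≥0, ℝ)) (t : ℝ≥0) ↦ f t)
  simpa using h.comap_le

lemma toPath_apply {f : ℝ≥0 → ℝ} (hf : Continuous f) (t : ℝ≥0) : toPath f t = f t := by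
  simp [toPath, hf]

variable {Ω : Type*} [MeasurableSpace Ω] {P : Measure Ω}

/-- The null set where `X t` differs from its measurable version depends on `t`. Restricting to a
countable dense set of times gives one good set `A`, and continuity recovers the other times. -/
lemma aemeasurable_toPath {X : ℝ≥0 → Ω → ℝ} (hX : ∀ t, AEMeasurable (X t) P)
    (hc : ∀ᵐ ω ∂P, Continuous (X · ω)) : AEMeasurable (fun ω ↦ toPath (X · ω)) P := by
  obtain ⟨D, hDc, hDd⟩ := TopologicalSpace.exists_countable_dense ℝ≥0
  have hall : ∀ᵐ ω ∂P, Continuous (X · ω) ∧ ∀ t ∈ D, X t ω = (hX t).mk _ ω :=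
    hc.and ((ae_ball_iff hDc).2 fun t _ ↦ (hX t).ae_eq_mk)
  obtain ⟨A, hAm, hAP, hA⟩ : ∃ A, MeasurableSet A ∧ P Aᶜ = 0 ∧
      ∀ ω ∈ A, Continuous (X · ω) ∧ ∀ t ∈ D, X t ω = (hX t).mk _ ω := by
    obtain ⟨A, hA, hm, h0⟩ := exists_measurable_superset_of_null (mem_ae_iff.1 hall)
    exact ⟨Aᶜ, hm.compl, by simpa using h0, fun ω hω ↦ by
      by_contra hcon
      exact hω (hA hcon)⟩
  classical
  let F : Ω → C(ℝ≥0, ℝ) := fun ω ↦ if ω ∈ A then toPath (X · ω) else 0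
  have hFD : ∀ t ∈ D, Measurable fun ω ↦ F ω t := by
    intro t ht
    have : (fun ω ↦ F ω t) = A.indicator ((hX t).mk _) := by
      ext ω
      by_cases h : ω ∈ A
      · simp [F, h, toPath_apply (hA ω h).1, (hA ω h).2 t ht]
      · simp [F, h]
    rw [this]
    exact (hX t).measurable_mk.indicator hAm
  have hF : Measurable F := by
    refine measurable_path_of_eval fun t ↦ ?_
    obtain ⟨u, huD, hu⟩ := mem_closure_iff_seq_limit.1 (hDd t)
    exact measurable_of_tendsto_metrizable (fun n ↦ hFD (u n) (huD n))
      (tendsto_pi_nhds.2 fun ω ↦ ((F ω).continuous.tendsto t).comp hu)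
  refine ⟨F, hF, ?_⟩
  filter_upwards [mem_ae_iff.2 hAP] with ω hω
  simp [F, hω]

lemma toPath_coe_ae_eq {X : ℝ≥0 → Ω → ℝ} (hc : ∀ᵐ ω ∂P, Continuous (X · ω)) :
    (fun ω t ↦ toPath (X · ω) t) =ᵐ[P] fun ω t ↦ X t ω := by
  filter_upwards [hc] with ω hω
  ext t
  exact toPath_apply hω t

lemma map_path_ext {μ ν : Measure C(ℝ≥0, ℝ)}
    (h : μ.map (fun f t ↦ f t) = ν.map (fun (f : C(ℝ≥0, ℝ)) (t : ℝ≥0) ↦ f t)) : μ = ν := by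
  ext s hs
  rw [← comap_path_coe] at hs
  obtain ⟨u, hu, rfl⟩ := hs
  rw [← Measure.map_apply measurable_path_coe hu, h, Measure.map_apply measurable_path_coe hu]

/-- The law on path space of a Brownian motion is unique. -/
lemma map_toPath_eq_of_brownian [IsFiniteMeasure P] {X Y : ℝ≥0 → Ω → ℝ}
    (hX : IsBrownianReal X P) (hY : IsBrownianReal Y P) :
    P.map (fun ω ↦ toPath (X · ω)) = P.map (fun ω ↦ toPath (Y · ω)) := by
  have mX := aemeasurable_toPath hX.aemeasurable hX.cont
  have mY := aemeasurable_toPath hY.aemeasurable hY.cont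
  refine map_path_ext ?_
  rw [AEMeasurable.map_map_of_aemeasurable measurable_path_coe.aemeasurable mX,
    AEMeasurable.map_map_of_aemeasurable measurable_path_coe.aemeasurable mY]
  have cX : AEMeasurable (fun ω (t : ℝ≥0) ↦ X t ω) P :=
    (measurable_path_coe.comp_aemeasurable mX).congr (toPath_coe_ae_eq hX.cont)
  have cY : AEMeasurable (fun ω (t : ℝ≥0) ↦ Y t ω) P :=
    (measurable_path_coe.comp_aemeasurable mY).congr (toPath_coe_ae_eq hY.cont)
  refine (Measure.map_congr (toPath_coe_ae_eq hX.cont)).trans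
    (Eq.trans ?_ (Measure.map_congr (toPath_coe_ae_eq hY.cont)).symm)
  rw [map_eq_iff_forall_finset_map_restrict_eq cX cY]
  exact fun I ↦ (hX.hasLaw I).map_eq.trans (hY.hasLaw I).map_eq.symm

/-- Independence of two processes with continuous paths passes to the path space. -/
lemma indepFun_toPath {X Y : ℝ≥0 → Ω → ℝ} (hX : ∀ᵐ ω ∂P, Continuous (X · ω))
    (hY : ∀ᵐ ω ∂P, Continuous (Y · ω))
    (h : IndepFun (fun ω t ↦ X t ω) (fun ω t ↦ Y t ω) P) :
    IndepFun (fun ω ↦ toPath (X · ω)) (fun ω ↦ toPath (Y · ω)) P := by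
  have h' := h.congr (toPath_coe_ae_eq hX).symm (toPath_coe_ae_eq hY).symm
  rw [IndepFun_iff_Indep] at h' ⊢
  rw [← comap_path_coe, MeasurableSpace.comap_comp, MeasurableSpace.comap_comp]
  exact h'

lemma measureReal_mul_bound [IsProbabilityMeasure P] {g : Ω → ℝ} {s : Set Ω} {a M : ℝ}
    (ha : 0 ≤ a) (hg : ∀ ω, |g ω| ≤ M) (hs : ∀ ω ∉ s, |g ω| ≤ a) :
    |∫ ω, g ω ∂P| ≤ a + M * P.real s := by
  have hM : 0 ≤ M := by
    obtain ⟨ω⟩ := nonempty_of_isProbabilityMeasure P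
    exact (abs_nonneg _).trans (hg ω)
  -- The exceptional set need not be measurable, so it is replaced by a measurable superset of equal
  -- measure.
  obtain ⟨t, hst, ht, hPt⟩ := exists_measurable_superset P s
  have hint : Integrable (fun ω ↦ a + t.indicator (fun _ ↦ M) ω) P :=
    (integrable_const a).add ((integrable_const M).indicator ht)
  have := norm_integral_le_of_norm_le hint (f := g) (ae_of_all _ fun ω ↦ by
    rw [Real.norm_eq_abs]
    by_cases h : ω ∈ t
    · simp only [h, Set.indicator_of_mem]
      linarith [hg ω]
    · simp only [h, not_false_eq_true, Set.indicator_of_notMem, add_zero]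
      exact hs ω fun h' ↦ h (hst h'))
  rw [integral_add (integrable_const a) ((integrable_const M).indicator ht),
    integral_indicator_const _ ht] at this
  simpa [Measure.real, hPt, mul_comm] using this

/-- If `Z i` has the law of `W` and `Y i` is close to `Z i` in probability, uniformly in the sense
of the uniform structure, then `Y` converges to `W` in distribution. -/
lemma tendstoInDistribution_of_uniform {E ι Ω' : Type*} [UniformSpace E]
    [(uniformity E).IsCountablyGenerated]
    [MeasurableSpace E] [BorelSpace E] [MeasurableSpace Ω'] {P' : Measure Ω'}
    [IsProbabilityMeasure P] [IsProbabilityMeasure P'] {l : Filter ι} [l.IsCountablyGenerated]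
    {Y Z : ι → Ω → E} {W : Ω' → E} (hY : ∀ i, AEMeasurable (Y i) P)
    (hZ : ∀ᶠ i in l, AEMeasurable (Z i) P) (hW : AEMeasurable W P')
    (hlaw : ∀ᶠ i in l, P.map (Z i) = P'.map W)
    (hYZ : ∀ V ∈ uniformity E, Tendsto (fun i ↦ P.real {ω | (Y i ω, Z i ω) ∉ V}) l (𝓝 0)) :
    TendstoInDistribution Y l W (fun _ ↦ P) P' := by
  let _ : PseudoMetricSpace E := UniformSpace.pseudoMetricSpace E
  refine ⟨hY, hW, ?_⟩
  refine tendsto_iff_forall_lipschitz_integral_tendsto.2 ?_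
  rintro f ⟨C, hC⟩ ⟨L, hL⟩
  have hfc : Continuous f := hL.continuous
  have hfm : Measurable f := hfc.measurable
  obtain ⟨ω₀⟩ := nonempty_of_isProbabilityMeasure P'
  have hbd : ∀ x, |f x| ≤ |f (W ω₀)| + C := fun x ↦ by
    have := hC x (W ω₀)
    rw [Real.dist_eq] at this
    linarith [abs_sub_abs_le_abs_sub (f x) (f (W ω₀))]
  have hi : ∀ (G : Ω → E), AEMeasurable G P → Integrable (fun ω ↦ f (G ω)) P := fun G hG ↦
    Integrable.of_bound (hfm.comp_aemeasurable hG).aestronglyMeasurable _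
      (ae_of_all _ fun ω ↦ hbd (G ω))
  rw [tendsto_iff_dist_tendsto_zero]
  rw [Metric.tendsto_nhds]
  intro ε hε
  have hV := Metric.uniformContinuous_iff.1 hL.uniformContinuous (ε / 2) (by positivity)
  obtain ⟨δ, hδ, hδf⟩ := hV
  have hsm := hYZ _ (Metric.dist_mem_uniformity hδ)
  have hsm2 : ∀ᶠ i in l, C * P.real {ω | (Y i ω, Z i ω) ∉ {p : E × E | dist p.1 p.2 < δ}}
      < ε / 2 := by
    have := hsm.const_mul C
    rw [mul_zero] at this
    exact this.eventually_lt_const (by positivity)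
  filter_upwards [hsm2, hZ, hlaw] with i hi1 hi2 hi3
  rw [dist_zero_right, Real.norm_eq_abs, abs_of_nonneg dist_nonneg, Real.dist_eq]
  simp only [ProbabilityMeasure.coe_mk]
  rw [← hi3, integral_map (hY i) hfm.aestronglyMeasurable,
    integral_map hi2 hfm.aestronglyMeasurable, ← integral_sub (hi _ (hY i)) (hi _ hi2)]
  have hb := measureReal_mul_bound (P := P) (a := ε / 2)
    (s := {ω | (Y i ω, Z i ω) ∉ {p : E × E | dist p.1 p.2 < δ}}) (by positivity)
    (fun ω ↦ hC (Y i ω) (Z i ω)) (fun ω hω ↦ by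
      simp only [Set.mem_ofPred_eq, not_not] at hω
      exact (hδf hω).le)
  exact hb.trans_lt (((add_lt_add_iff_left _).2 hi1).trans_eq (add_halves ε))

end

/-! ### Growth of Brownian paths and limits of Gaussian variables -/

section

variable {Ω : Type*} [MeasurableSpace Ω] {P : Measure Ω}

/-- Countably many times suffice to transfer a bound on a supremum, and no path continuity is
needed. This matters for the time-inverted process, which is used only as a pre-Brownian one. -/
lemma map_comp_eq_of_preBrownian [IsFiniteMeasure P] {ι : Type*} [Countable ι]
    {X Y : ℝ≥0 → Ω → ℝ} (hX : IsPreBrownianReal X P) (hY : IsPreBrownianReal Y P) (τ : ι → ℝ≥0) :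
    P.map (fun ω i ↦ X (τ i) ω) = P.map (fun ω i ↦ Y (τ i) ω) := by
  classical
  have mX : AEMeasurable (fun ω i ↦ X (τ i) ω) P :=
    aemeasurable_pi_lambda _ fun i ↦ hX.aemeasurable _
  have mY : AEMeasurable (fun ω i ↦ Y (τ i) ω) P :=
    aemeasurable_pi_lambda _ fun i ↦ hY.aemeasurable _
  refine (map_eq_iff_forall_finset_map_restrict_eq mX mY).2 fun I ↦ ?_
  let g : (I.image τ → ℝ) → I → ℝ := fun x i ↦ x ⟨τ i, Finset.mem_image_of_mem τ i.2⟩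
  have hg : Measurable g := measurable_pi_lambda _ fun i ↦ measurable_pi_apply _
  have hX' := hX.hasLaw (I.image τ)
  have hY' := hY.hasLaw (I.image τ)
  have eX := AEMeasurable.map_map_of_aemeasurable hg.aemeasurable hX'.aemeasurable
  have eY := AEMeasurable.map_map_of_aemeasurable hg.aemeasurable hY'.aemeasurable
  rw [hX'.map_eq] at eX
  rw [hY'.map_eq] at eY
  exact eX.symm.trans eY

/-- Brownian motion grows at most linearly, by time inversion. -/
lemma ae_linear_growth_of_brownian [IsProbabilityMeasure P] {X : ℝ≥0 → Ω → ℝ}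
    (hX : IsBrownianReal X P) :
    ∀ᵐ ω ∂P, ∃ K : ℝ, ∀ t : ℝ≥0, |X t ω| ≤ K * (1 + t) := by
  obtain ⟨D, hDc, hDd⟩ := TopologicalSpace.exists_countable_dense ℝ≥0
  -- At time `1 / i` the inverted process equals `X i / i`. Boundedness of `X` on `[0, 1]` thus
  -- becomes, by equality in law, boundedness of `X t / t` over a dense set of `t > 1`.
  let ι := ↥(Set.Ioi (1 : ℝ≥0) ∩ D)
  have : Countable ι := (hDc.mono Set.inter_subset_right).to_subtype
  let τ : ι → ℝ≥0 := fun i ↦ 1 / (i : ℝ≥0)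
  have hW := hX.toIsPreBrownianReal.inv
  have hlaw := map_comp_eq_of_preBrownian hX.toIsPreBrownianReal hW τ
  have mX : AEMeasurable (fun ω i ↦ X (τ i) ω) P :=
    aemeasurable_pi_lambda _ fun i ↦ hX.aemeasurable _
  have mW : AEMeasurable (fun ω i ↦ (fun (t : ℝ≥0) ω ↦ (t : ℝ) * X (1 / t) ω) (τ i) ω) P :=
    aemeasurable_pi_lambda _ fun i ↦ hW.aemeasurable _
  let S : Set (ι → ℝ) := {f | ∃ K : ℕ, ∀ i, |f i| ≤ K}
  have hS : MeasurableSet S := by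
    have : S = ⋃ K : ℕ, ⋂ i, {f : ι → ℝ | |f i| ≤ K} := by ext; simp [S]
    rw [this]
    exact .iUnion fun K ↦ .iInter fun i ↦
      measurableSet_le (measurable_pi_apply i).norm measurable_const
  have h1 : ∀ᵐ ω ∂P, (fun i ↦ X (τ i) ω) ∈ S := by
    filter_upwards [hX.cont] with ω hω
    obtain ⟨C, hC⟩ := (isCompact_Icc (a := (0 : ℝ≥0)) (b := 1)).exists_bound_of_continuousOn
      hω.continuousOn
    obtain ⟨K, hK⟩ := exists_nat_ge C
    refine ⟨K, fun i ↦ (hC (τ i) ⟨zero_le, ?_⟩).trans hK⟩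
    exact div_le_one_of_le₀ (le_of_lt i.2.1) zero_le
  have h2 : ∀ᵐ ω ∂P, (fun i ↦ (τ i : ℝ) * X (1 / τ i) ω) ∈ S := by
    have h1' := (ae_map_iff mX hS).2 h1
    rw [hlaw] at h1'
    exact (ae_map_iff mW hS).1 h1'
  filter_upwards [h2, hX.cont] with ω ⟨K, hK⟩ hc
  obtain ⟨C, hC⟩ := (isCompact_Icc (a := (0 : ℝ≥0)) (b := 1)).exists_bound_of_continuousOn
    hc.continuousOn
  have hC0 : 0 ≤ C := (norm_nonneg _).trans (hC 0 ⟨le_rfl, zero_le⟩)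
  have hcl : IsClosed {t : ℝ≥0 | |X t ω| ≤ K * t} :=
    isClosed_le (by fun_prop) (by fun_prop)
  have hsub : Set.Ioi (1 : ℝ≥0) ⊆ {t : ℝ≥0 | |X t ω| ≤ K * t} := by
    refine (hDd.open_subset_closure_inter isOpen_Ioi).trans (closure_minimal ?_ hcl)
    intro t ht
    have := hK ⟨t, ht⟩
    have ht1 : (1 : ℝ) < t := by exact_mod_cast ht.1
    simp only [τ, one_div_one_div, abs_mul, NNReal.coe_div, NNReal.coe_one,
      abs_of_pos (one_div_pos.2 (zero_lt_one.trans ht1))] at this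
    rw [one_div, inv_mul_le_iff₀ (by linarith)] at this
    simpa [mul_comm] using this
  refine ⟨C + K, fun t ↦ ?_⟩
  have hK0 : (0 : ℝ) ≤ K := K.cast_nonneg
  have ht0 := t.coe_nonneg
  rcases le_or_gt t 1 with ht | ht
  · have := hC t ⟨zero_le, ht⟩
    rw [Real.norm_eq_abs] at this
    nlinarith [mul_nonneg hC0 ht0, mul_nonneg hK0 ht0]
  · have : |X t ω| ≤ K * t := hsub ht
    nlinarith [mul_nonneg hC0 ht0, mul_nonneg hK0 ht0]

lemma charFun_map_of_centered {X : Ω → ℝ} (hX : HasGaussianLaw X P) (h0 : ∫ ω, X ω ∂P = 0)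
    (t : ℝ) : charFun (P.map X) t = ((Real.exp (-(Var[X; P] * t ^ 2 / 2)) : ℝ) : ℂ) := by
  rw [hX.map_eq_gaussianReal, charFun_gaussianReal, h0]
  push_cast
  congr 1
  rw [Real.coe_toNNReal _ (variance_nonneg _ _)]
  ring

/-- An almost sure limit of centred Gaussian random variables is Gaussian. -/
lemma hasGaussianLaw_of_ae_tendsto [IsProbabilityMeasure P] {X : ℕ → Ω → ℝ} {Y : Ω → ℝ}
    (hX : ∀ n, HasGaussianLaw (X n) P) (h0 : ∀ n, ∫ ω, X n ω ∂P = 0)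
    (hXY : ∀ᵐ ω ∂P, Tendsto (fun n ↦ X n ω) atTop (𝓝 (Y ω))) : HasGaussianLaw Y P := by
  have mY : AEMeasurable Y P :=
    aemeasurable_of_tendsto_metrizable_ae' (fun n ↦ (hX n).aemeasurable) hXY
  have : IsProbabilityMeasure (P.map Y) := Measure.isProbabilityMeasure_map mY
  set v : ℕ → ℝ := fun n ↦ Var[X n; P] with hv
  have hv0 : ∀ n, 0 ≤ v n := fun n ↦ variance_nonneg _ _
  have hlim : ∀ t, Tendsto (fun n ↦ ((Real.exp (-(v n * t ^ 2 / 2)) : ℝ) : ℂ)) atTop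
      (𝓝 (charFun (P.map Y) t)) := by
    intro t
    simp_rw [hv, ← fun n ↦ charFun_map_of_centered (hX n) (h0 n) t, charFun_apply_real]
    rw [integral_map mY (by fun_prop)]
    have : ∀ n, ∫ x, Complex.exp (t * x * Complex.I) ∂(P.map (X n)) =
        ∫ ω, Complex.exp (t * X n ω * Complex.I) ∂P := fun n ↦
      integral_map (hX n).aemeasurable (by fun_prop)
    simp_rw [this]
    refine tendsto_integral_of_dominated_convergence (fun _ ↦ 1) (fun n ↦ ?_)
      (integrable_const _) (fun n ↦ ae_of_all _ fun ω ↦ ?_) ?_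
    · have := (hX n).aemeasurable
      exact AEMeasurable.aestronglyMeasurable (by fun_prop)
    · rw [← Complex.ofReal_mul, Complex.norm_exp_ofReal_mul_I]
    · filter_upwards [hXY] with ω hω
      have hc : Continuous fun x : ℝ ↦ Complex.exp (t * x * Complex.I) := by fun_prop
      exact (hc.tendsto _).comp hω
  have hre : ∀ t, Tendsto (fun n ↦ Real.exp (-(v n * t ^ 2 / 2))) atTop
      (𝓝 (charFun (P.map Y) t).re) := fun t ↦ by
    have h := Tendsto.comp (Complex.continuous_re.tendsto _) (hlim t)
    exact h.congr fun n ↦ Complex.ofReal_re _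
  -- The limiting characteristic function is positive at some `t > 0` by continuity at `0`; taking
  -- logarithms there shows that the variances converge.
  obtain ⟨w, hw⟩ : ∃ w, Tendsto v atTop (𝓝 w) := by
    obtain ⟨t, ht0, ht⟩ : ∃ t : ℝ, 0 < t ∧ 0 < (charFun (P.map Y) t).re := by
      have hc : Continuous fun t ↦ (charFun (P.map Y) t).re :=
        Complex.continuous_re.comp (by fun_prop)
      have : ∀ᶠ t in 𝓝 (0 : ℝ), 0 < (charFun (P.map Y) t).re :=
        (hc.tendsto 0).eventually_const_lt (by simp)
      obtain ⟨δ, hδ, h⟩ := Metric.eventually_nhds_iff.1 this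
      exact ⟨δ / 2, by positivity, h (by simp [abs_of_pos hδ]; linarith)⟩
    have hl := ((Real.continuousAt_log ht.ne').tendsto.comp (hre t)).const_mul (-(2 / t ^ 2))
    refine ⟨_, hl.congr fun n ↦ ?_⟩
    simp only [Function.comp_apply, Real.log_exp]
    field_simp
  have hw0 : 0 ≤ w := ge_of_tendsto' hw hv0
  have : P.map Y = gaussianReal 0 w.toNNReal := by
    refine Measure.ext_of_charFun (funext fun t ↦ ?_)
    refine tendsto_nhds_unique (hlim t) ?_
    rw [charFun_gaussianReal]
    have hc : Continuous fun x : ℝ ↦ ((Real.exp (-(x * t ^ 2 / 2)) : ℝ) : ℂ) := by fun_prop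
    convert! (hc.tendsto w).comp hw using 2
    push_cast
    congr 1
    rw [Real.coe_toNNReal _ hw0]
    ring
  constructor
  rw [this]
  infer_instance

end

/-! ### The heat kernel and the averaging formula for the velocity -/

lemma integrable_sq_mul_gaussian {c : ℝ} (hc : 0 < c) :
    Integrable fun w : ℝ ↦ (1 + w ^ 2) ^ 2 * Real.exp (-c * w ^ 2) := by
  have h0 := integrable_exp_neg_mul_sq hc
  have h2 := integrable_rpow_mul_exp_neg_mul_sq hc (s := 2) (by norm_num)
  have h4 := integrable_rpow_mul_exp_neg_mul_sq hc (s := 4) (by norm_num)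
  refine ((h0.add (h2.const_mul 2)).add h4).congr (ae_of_all _ fun w ↦ ?_)
  have e2 : w ^ (2 : ℝ) = w ^ 2 := by exact_mod_cast Real.rpow_natCast w 2
  have e4 : w ^ (4 : ℝ) = w ^ 4 := by exact_mod_cast Real.rpow_natCast w 4
  simp only [Pi.add_apply, e2, e4]
  ring

/-- Minus the derivative of the heat kernel at time one. -/
noncomputable def profile (z : ℝ) : ℝ := -(z / 2) * heatKernel 1 z

lemma continuous_heatKernel (t : ℝ) : Continuous (heatKernel t) := by
  unfold heatKernel
  fun_prop

lemma continuous_profile : Continuous profile := by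
  have := continuous_heatKernel 1
  unfold profile
  fun_prop

lemma heatKernel_nonneg (t x : ℝ) : 0 ≤ heatKernel t x := by
  unfold heatKernel
  positivity

lemma abs_le_one_add_sq (z : ℝ) : |z| ≤ 1 + z ^ 2 := by
  nlinarith [sq_nonneg (|z| - 1), sq_abs z]

lemma one_add_add_sq_le (x y : ℝ) : 1 + (x + y) ^ 2 ≤ 2 * (1 + x ^ 2) * (1 + y ^ 2) := by
  nlinarith [sq_nonneg (x - y), sq_nonneg (x * y)]

lemma integrable_profile_mul : Integrable fun z ↦ |profile z| * (1 + z ^ 2) := by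
  refine ((integrable_sq_mul_gaussian (c := 1 / 4) (by norm_num)).const_mul
    (√(4 * Real.pi * 1))⁻¹).mono' ?_ (ae_of_all _ fun z ↦ ?_)
  · have := continuous_profile
    exact Continuous.aestronglyMeasurable (by fun_prop)
  have h1 : |profile z| ≤ (1 + z ^ 2) * heatKernel 1 z := by
    rw [profile, abs_mul, abs_of_nonneg (heatKernel_nonneg 1 z), abs_neg, abs_div, abs_two]
    have := abs_le_one_add_sq z
    have := abs_nonneg z
    exact mul_le_mul_of_nonneg_right (by linarith) (heatKernel_nonneg 1 z)
  rw [Real.norm_eq_abs, abs_mul, abs_abs, abs_of_nonneg (by positivity : 0 ≤ 1 + z ^ 2)]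
  calc _ ≤ ((1 + z ^ 2) * heatKernel 1 z) * (1 + z ^ 2) := by gcongr
    _ = _ := by
      unfold heatKernel
      rw [show -z ^ 2 / (4 * 1) = -(1 / 4) * z ^ 2 by ring]
      field_simp

/-- The quadratic moment of `profile`. -/
noncomputable def profileMoment : ℝ := ∫ z, |profile z| * (1 + z ^ 2)

lemma profileMoment_nonneg : 0 ≤ profileMoment :=
  integral_nonneg fun z ↦ by positivity

/-- Quadratic growth takes the form `A (1 + s z²)` after substituting `y = √s z`; bounding `s` by
`M` makes the constant uniform over times up to `M`. -/
lemma profile_mul_bound {f : ℝ → ℝ} {A s M : ℝ} (hA : 0 ≤ A) (hs : 0 ≤ s) (hsM : s ≤ M)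
    (hf : ∀ z, |f z| ≤ A * (1 + s * z ^ 2)) (z : ℝ) :
    ‖profile z * f z‖ ≤ A * (1 + M) * (|profile z| * (1 + z ^ 2)) := by
  rw [norm_mul, Real.norm_eq_abs, Real.norm_eq_abs]
  have : 1 + s * z ^ 2 ≤ (1 + M) * (1 + z ^ 2) := by
    nlinarith [sq_nonneg z, mul_le_mul_of_nonneg_right hsM (sq_nonneg z)]
  calc |profile z| * |f z| ≤ |profile z| * (A * ((1 + M) * (1 + z ^ 2))) := by
        gcongr
        exact (hf z).trans (by gcongr)
    _ = _ := by ring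

lemma abs_integral_profile_mul_le {f : ℝ → ℝ} {A s M : ℝ} (hA : 0 ≤ A) (hs : 0 ≤ s) (hsM : s ≤ M)
    (hf : ∀ z, |f z| ≤ A * (1 + s * z ^ 2)) :
    |∫ z, profile z * f z| ≤ A * (1 + M) * profileMoment := by
  have := norm_integral_le_of_norm_le (integrable_profile_mul.const_mul (A * (1 + M)))
    (ae_of_all _ (profile_mul_bound hA hs hsM hf))
  rwa [integral_const_mul] at this

lemma integrable_profile_mul_of_le {f : ℝ → ℝ} {A s : ℝ} (hA : 0 ≤ A) (hs : 0 ≤ s)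
    (hfc : Continuous f) (hf : ∀ z, |f z| ≤ A * (1 + s * z ^ 2)) :
    Integrable fun z ↦ profile z * f z :=
  (integrable_profile_mul.const_mul (A * (1 + s))).mono'
    (continuous_profile.mul hfc).aestronglyMeasurable
    (ae_of_all _ (profile_mul_bound hA hs le_rfl hf))

lemma hasDerivAt_heatKernel (t w : ℝ) :
    HasDerivAt (heatKernel t) (-(w / (2 * t)) * heatKernel t w) w := by
  unfold heatKernel
  have h := (((hasDerivAt_pow 2 w).neg.div_const (4 * t)).exp).div_const (√(4 * Real.pi * t))
  refine h.congr_deriv ?_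
  simp only [Nat.cast_ofNat, Nat.add_one_sub_one, pow_one, Pi.neg_apply]
  rcases eq_or_ne t 0 with rfl | ht
  · simp
  · field_simp
    ring

lemma heatKernel_sqrt_mul {t : ℝ} (ht : 0 < t) (z : ℝ) :
    heatKernel t (√t * z) = heatKernel 1 z / √t := by
  unfold heatKernel
  rw [mul_pow, Real.sq_sqrt ht.le, Real.sqrt_mul' _ ht.le, mul_one, mul_one,
    show -(t * z ^ 2) / (4 * t) = -z ^ 2 / 4 by field_simp, div_div]

/-- The velocity field as an average of the environment. -/
lemma velocity_eq {b : ℝ → ℝ} (hb : Continuous b) {K : ℝ} (hK : ∀ y, |b y| ≤ K * (1 + y ^ 2))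
    {t : ℝ} (ht : 0 < t) (x : ℝ) :
    velocity b t x = (√t)⁻¹ * ∫ z, profile z * b (x + √t * z) := by
  have hK0 : 0 ≤ K := by
    have := (abs_nonneg _).trans (hK 0)
    simpa using this
  -- Half of the Gaussian rate `1 / (4t)` is given up to dominate all `x'` in the unit ball, through
  -- `(x' - y)² ≥ (x - y)² / 2 - 1`.
  set c : ℝ := 1 / (8 * t) with hc
  have hcpos : 0 < c := by positivity
  set A : ℝ := 2 * (1 / (2 * t)) * (Real.exp (1 / (4 * t)) / √(4 * Real.pi * t)) *
    (K * (2 * (1 + x ^ 2))) with hA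
  have hcont := continuous_heatKernel t
  have hgauss : Integrable fun y ↦ A * ((1 + (x - y) ^ 2) ^ 2 * Real.exp (-c * (x - y) ^ 2)) :=
    ((integrable_sq_mul_gaussian hcpos).comp_sub_left x).const_mul A
  have hy : ∀ y, 1 + y ^ 2 ≤ 2 * (1 + x ^ 2) * (1 + (x - y) ^ 2) := fun y ↦ by
    have := one_add_add_sq_le x (-(x - y))
    rwa [show x + -(x - y) = y by ring, neg_sq] at this
  have hker : ∀ x' ∈ Metric.ball x 1, ∀ y, heatKernel t (x' - y) ≤
      Real.exp (1 / (4 * t)) / √(4 * Real.pi * t) * Real.exp (-c * (x - y) ^ 2) := by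
    intro x' hx' y
    rw [Metric.mem_ball, Real.dist_eq, abs_lt] at hx'
    unfold heatKernel
    rw [div_mul_eq_mul_div, ← Real.exp_add]
    gcongr
    rw [hc, div_le_iff₀ (by positivity)]
    have : (1 / (4 * t) + -(1 / (8 * t)) * (x - y) ^ 2) * (4 * t) = 1 - (x - y) ^ 2 / 2 := by
      field_simp
      ring
    rw [this]
    nlinarith [sq_nonneg (2 * (x' - x) + (x - y))]
  have hbound : ∀ᵐ y, ∀ x' ∈ Metric.ball x 1,
      ‖-((x' - y) / (2 * t)) * heatKernel t (x' - y) * b y‖ ≤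
        A * ((1 + (x - y) ^ 2) ^ 2 * Real.exp (-c * (x - y) ^ 2)) := by
    refine ae_of_all _ fun y x' hx' ↦ ?_
    have hk := hker x' hx' y
    have hw : |x' - y| ≤ 2 * (1 + (x - y) ^ 2) := by
      rw [Metric.mem_ball, Real.dist_eq] at hx'
      have := abs_add_le (x' - x) (x - y)
      rw [sub_add_sub_cancel] at this
      nlinarith [abs_le_one_add_sq (x - y), sq_nonneg (x - y)]
    rw [norm_mul, norm_mul, norm_neg, norm_div, Real.norm_of_nonneg (heatKernel_nonneg _ _),
      Real.norm_of_nonneg (by positivity : 0 ≤ 2 * t), Real.norm_eq_abs, Real.norm_eq_abs]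
    calc |x' - y| / (2 * t) * heatKernel t (x' - y) * |b y|
        ≤ 2 * (1 + (x - y) ^ 2) / (2 * t) *
          (Real.exp (1 / (4 * t)) / √(4 * Real.pi * t) * Real.exp (-c * (x - y) ^ 2)) *
          (K * (2 * (1 + x ^ 2) * (1 + (x - y) ^ 2))) := by
          have := heatKernel_nonneg t (x' - y)
          gcongr
          exact (hK y).trans (by gcongr; exact hy y)
      _ = _ := by rw [hA]; ring
  have hint : Integrable fun y ↦ heatKernel t (x - y) * b y := by
    refine (hgauss.const_mul t).mono' (Continuous.aestronglyMeasurable (by fun_prop))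
      (ae_of_all _ fun y ↦ ?_)
    have hk := hker x (Metric.mem_ball_self one_pos) y
    rw [norm_mul, Real.norm_of_nonneg (heatKernel_nonneg _ _), Real.norm_eq_abs]
    have h1 : 1 + (x - y) ^ 2 ≤ (1 + (x - y) ^ 2) ^ 2 := by nlinarith [sq_nonneg (x - y)]
    calc heatKernel t (x - y) * |b y|
        ≤ (Real.exp (1 / (4 * t)) / √(4 * Real.pi * t) * Real.exp (-c * (x - y) ^ 2)) *
          (K * (2 * (1 + x ^ 2) * (1 + (x - y) ^ 2) ^ 2)) := by
          gcongr
          exact (hK y).trans (by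
            gcongr
            exact (hy y).trans (by gcongr))
      _ = _ := by rw [hA]; field_simp
  have hder : HasDerivAt (fun z ↦ ∫ y, heatKernel t (z - y) * b y)
      (∫ y, -((x - y) / (2 * t)) * heatKernel t (x - y) * b y) x := by
    refine (hasDerivAt_integral_of_dominated_loc_of_deriv_le (Metric.ball_mem_nhds x one_pos)
      (Eventually.of_forall fun z ↦ Continuous.aestronglyMeasurable (by fun_prop)) hint
      (Continuous.aestronglyMeasurable (by fun_prop)) hbound hgauss
      (ae_of_all _ fun y z _ ↦ ?_)).2
    exact ((hasDerivAt_heatKernel t (z - y)).comp_sub_const z y).mul_const (b y)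
  have hs : 0 < √t := Real.sqrt_pos.2 ht
  have hss : √t * √t = t := Real.mul_self_sqrt ht.le
  have hpot : (fun z ↦ potential b t z) = fun z ↦ ∫ y, heatKernel t (z - y) * b y := by
    ext z
    simp [potential, ht.ne']
  rw [velocity, hpot, hder.deriv, ← integral_neg]
  -- Substitute `y = x + √t z`. The kernel derivative is odd, so its value at `-√t z` absorbs the
  -- minus sign in the velocity.
  have h1 := integral_add_left_eq_self (μ := volume)
    (fun y ↦ -(-((x - y) / (2 * t)) * heatKernel t (x - y) * b y)) x
  have h2 := Measure.integral_comp_mul_left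
    (fun y ↦ -(-((x - (x + y)) / (2 * t)) * heatKernel t (x - (x + y)) * b (x + y))) (√t)
  rw [← h1]
  rw [abs_of_pos (inv_pos.2 hs), smul_eq_mul, eq_inv_mul_iff_mul_eq₀ hs.ne'] at h2
  rw [← h2, eq_inv_mul_iff_mul_eq₀ hs.ne', ← mul_assoc, hss, ← integral_const_mul]
  congr 1
  ext z
  have hsym : heatKernel t (x - (x + √t * z)) = heatKernel 1 z / √t := by
    rw [← heatKernel_sqrt_mul ht]
    unfold heatKernel
    congr 3
    ring
  rw [hsym, profile]
  field_simp
  ring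

lemma intervalIntegrable_inv_sqrt {θ : ℝ} (hθ : 0 ≤ θ) :
    IntervalIntegrable (fun s ↦ (√s)⁻¹) volume 0 θ := by
  refine (intervalIntegral.intervalIntegrable_rpow' (a := 0) (b := θ) (r := -(1 / 2))
    (by norm_num)).congr fun s hs ↦ ?_
  rw [Set.uIoc_of_le hθ] at hs
  simp only [Real.sqrt_eq_rpow, Real.rpow_neg hs.1.le]

/-- The function controlling the size of integrated velocities up to time `M`. -/
noncomputable def timeConst (M : ℝ) : ℝ :=
  (∫ s in (0 : ℝ)..M, (√s)⁻¹) * ((1 + M) * profileMoment)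

/-! ### Deterministic estimates for the particle -/

section Drift

variable {b : ℝ → ℝ} {K : ℝ}

lemma nonneg_of_growth (hK : ∀ y, |b y| ≤ K * (1 + y ^ 2)) : 0 ≤ K := by
  have := (abs_nonneg _).trans (hK 0)
  simpa using this

lemma abs_velocity_zero_le (hb : Continuous b) (hK : ∀ y, |b y| ≤ K * (1 + y ^ 2)) {s M : ℝ}
    (hs : 0 < s) (hsM : s ≤ M) :
    |velocity b s 0| ≤ (√s)⁻¹ * (K * ((1 + M) * profileMoment)) := by
  rw [velocity_eq hb hK hs, abs_mul, abs_of_nonneg (inv_nonneg.2 (Real.sqrt_nonneg s))]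
  gcongr
  rw [← mul_assoc]
  refine abs_integral_profile_mul_le (nonneg_of_growth hK) hs.le hsM fun z ↦ ?_
  have := hK (0 + √s * z)
  rwa [zero_add, mul_pow, Real.sq_sqrt hs.le, ← zero_add (√s * z)] at this

lemma growth_add_sqrt_mul (hK : ∀ y, |b y| ≤ K * (1 + y ^ 2)) {s : ℝ} (hs : 0 ≤ s) (x z : ℝ) :
    |b (x + √s * z)| ≤ K * (2 * (1 + x ^ 2)) * (1 + s * z ^ 2) := by
  have h := one_add_add_sq_le x (√s * z)
  rw [mul_pow √s, Real.sq_sqrt hs] at h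
  refine (hK _).trans ?_
  rw [mul_assoc]
  exact mul_le_mul_of_nonneg_left h (nonneg_of_growth hK)

/-- The increment in `x` falls on `b` inside the average, so only the modulus of continuity of `b`
enters, at the integrable price `s^{-1/2}`. -/
lemma abs_velocity_sub_le (hb : Continuous b) (hK : ∀ y, |b y| ≤ K * (1 + y ^ 2)) {ρ r : ℝ}
    (hρ : 0 ≤ ρ) (hr : ∀ y h, |h| ≤ r → |b (h + y) - b y| ≤ ρ * (1 + y ^ 2)) {s M x : ℝ}
    (hs : 0 < s) (hsM : s ≤ M) (hx : |x| ≤ r) :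
    |velocity b s x - velocity b s 0| ≤ (√s)⁻¹ * (ρ * ((1 + M) * profileMoment)) := by
  have hi : ∀ x, Integrable fun z ↦ profile z * b (x + √s * z) := fun x ↦
    integrable_profile_mul_of_le (by have := nonneg_of_growth hK; positivity) hs.le (by fun_prop)
      (growth_add_sqrt_mul hK hs.le x)
  rw [velocity_eq hb hK hs, velocity_eq hb hK hs, ← mul_sub, ← integral_sub (hi x) (hi 0), abs_mul,
    abs_of_nonneg (inv_nonneg.2 (Real.sqrt_nonneg s))]
  gcongr
  rw [← mul_assoc]
  simp_rw [← mul_sub]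
  refine abs_integral_profile_mul_le hρ hs.le hsM fun z ↦ ?_
  have := hr (√s * z) x hx
  rwa [zero_add, ← Real.sq_sqrt hs.le, ← mul_pow, Real.sqrt_sq (Real.sqrt_nonneg s)]

lemma intervalIntegrable_velocity_comp (hb : Continuous b) (hK : ∀ y, |b y| ≤ K * (1 + y ^ 2))
    {Y : ℝ → ℝ} (hY : Continuous Y) {θ : ℝ} (hθ : 0 ≤ θ) :
    IntervalIntegrable (fun s ↦ velocity b s (Y s)) volume 0 θ := by
  obtain ⟨R, hR⟩ := (isCompact_Icc (a := 0) (b := θ)).exists_bound_of_continuousOn hY.continuousOn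
  have hK0 := nonneg_of_growth hK
  refine ((intervalIntegrable_inv_sqrt hθ).mul_const
    (K * (2 * (1 + R ^ 2)) * (1 + θ) * profileMoment)).mono_fun' ?_ ?_
  · have hm : StronglyMeasurable fun s ↦ (√s)⁻¹ * ∫ z, profile z * b (Y s + √s * z) := by
      refine (by fun_prop : Measurable fun s : ℝ ↦ (√s)⁻¹).stronglyMeasurable.mul ?_
      refine StronglyMeasurable.integral_prod_right'
        (f := fun p : ℝ × ℝ ↦ profile p.2 * b (Y p.1 + √p.1 * p.2)) ?_
      have := continuous_profile
      exact Continuous.stronglyMeasurable (by fun_prop)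
    refine hm.aestronglyMeasurable.congr ?_
    rw [Set.uIoc_of_le hθ]
    filter_upwards [ae_restrict_mem measurableSet_Ioc] with s hs
    rw [velocity_eq hb hK hs.1]
  · rw [Set.uIoc_of_le hθ]
    filter_upwards [ae_restrict_mem measurableSet_Ioc] with s hs
    rw [velocity_eq hb hK hs.1, norm_mul, Real.norm_of_nonneg (inv_nonneg.2 (Real.sqrt_nonneg s)),
      Real.norm_eq_abs]
    gcongr
    refine abs_integral_profile_mul_le (by positivity) hs.1.le hs.2 fun z ↦ ?_
    refine (growth_add_sqrt_mul hK hs.1.le _ z).trans ?_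
    have h1 := hR s ⟨hs.1.le, hs.2⟩
    have h2 : Y s ^ 2 ≤ R ^ 2 := by
      rw [← sq_abs]
      exact pow_le_pow_left₀ (abs_nonneg _) h1 2
    have := hs.1.le
    gcongr

lemma intervalIntegrable_velocity_zero (hb : Continuous b) (hK : ∀ y, |b y| ≤ K * (1 + y ^ 2))
    {θ : ℝ} (hθ : 0 ≤ θ) : IntervalIntegrable (fun s ↦ velocity b s 0) volume 0 θ :=
  intervalIntegrable_velocity_comp hb hK (Y := fun _ ↦ 0) continuous_const hθ

lemma continuous_integratedVelocity (hb : Continuous b) (hK : ∀ y, |b y| ≤ K * (1 + y ^ 2)) :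
    Continuous (integratedVelocity b) := by
  refine continuous_iff_continuousAt.2 fun θ ↦ ?_
  have h0 : (0 : ℝ) ≤ θ + 1 := by positivity
  have h := intervalIntegral.continuousOn_primitive_interval'
    (intervalIntegrable_velocity_zero hb hK h0) Set.left_mem_uIcc
  rw [Set.uIcc_of_le h0] at h
  refine (h θ ⟨θ.coe_nonneg, by simp⟩).tendsto.comp
    (tendsto_nhdsWithin_iff.2 ⟨NNReal.continuous_coe.tendsto θ, ?_⟩)
  have : ∀ᶠ η : ℝ≥0 in 𝓝 θ, η < θ + 1 := eventually_lt_nhds (by simp)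
  filter_upwards [this] with η hη
  exact ⟨η.coe_nonneg, by exact_mod_cast hη.le⟩

/-- The bound is asked for only on the open interval because the exit argument controls the particle
only strictly before its exit time. -/
lemma abs_integral_le_timeConst {f : ℝ → ℝ} {A θ M : ℝ} (hA : 0 ≤ A) (hθ : 0 ≤ θ) (hθM : θ ≤ M)
    (hf : ∀ s ∈ Set.Ioo 0 θ, |f s| ≤ (√s)⁻¹ * (A * ((1 + M) * profileMoment))) :
    |∫ s in (0 : ℝ)..θ, f s| ≤ A * timeConst M := by
  have h1 : ‖∫ s in (0 : ℝ)..θ, f s‖ ≤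
      ∫ s in (0 : ℝ)..θ, (√s)⁻¹ * (A * ((1 + M) * profileMoment)) := by
    refine intervalIntegral.norm_integral_le_of_norm_le hθ ?_
      ((intervalIntegrable_inv_sqrt hθ).mul_const _)
    have : ∀ᵐ s : ℝ, s ≠ θ := by simp [ae_iff]
    filter_upwards [this] with s hs hs'
    exact hf s ⟨hs'.1, lt_of_le_of_ne hs'.2 hs⟩
  have hm := profileMoment_nonneg
  have hM : 0 ≤ M := hθ.trans hθM
  rw [intervalIntegral.integral_mul_const] at h1
  refine h1.trans ?_
  have h2 : ∫ s in (0 : ℝ)..θ, (√s)⁻¹ ≤ ∫ s in (0 : ℝ)..M, (√s)⁻¹ :=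
    intervalIntegral.integral_mono_interval le_rfl hθ hθM
      (ae_of_all _ fun s ↦ inv_nonneg.2 (Real.sqrt_nonneg s)) (intervalIntegrable_inv_sqrt hM)
  calc _ ≤ (∫ s in (0 : ℝ)..M, (√s)⁻¹) * (A * ((1 + M) * profileMoment)) := by gcongr
    _ = _ := by rw [timeConst]; ring

/-- A particle with a small coupling `ε` stays close to the integrated velocity at the origin. -/
lemma abs_sub_integral_velocity_le (hb : Continuous b) (hK : ∀ y, |b y| ≤ K * (1 + y ^ 2))
    {ρ r ε M : ℝ} (hρ : 0 ≤ ρ) (hr : ∀ y h, |h| ≤ r → |b (h + y) - b y| ≤ ρ * (1 + y ^ 2))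
    (hε : 0 ≤ ε) {Y : ℝ → ℝ} (hY : Continuous Y) (hY0 : Y 0 = 0)
    (hder : ∀ s, 0 < s → HasDerivAt Y (velocity b s (ε * Y s)) s)
    (hsmall : ε * ((K + ρ) * timeConst M) < r) {θ : ℝ} (hθ : 0 ≤ θ) (hθM : θ ≤ M) :
    |Y θ - ∫ s in (0 : ℝ)..θ, velocity b s 0| ≤ ρ * timeConst M := by
  have hK0 := nonneg_of_growth hK
  have hint : ∀ θ, 0 ≤ θ → ∫ s in (0 : ℝ)..θ, velocity b s (ε * Y s) = Y θ := fun θ hθ ↦ by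
    rw [intervalIntegral.integral_eq_sub_of_hasDerivAt_of_le hθ hY.continuousOn
      (fun s hs ↦ hder s hs.1)
      (intervalIntegrable_velocity_comp hb hK (Y := fun s ↦ ε * Y s) (by fun_prop) hθ), hY0,
      sub_zero]
  have hstep : ∀ θ, 0 ≤ θ → θ ≤ M → (∀ s ∈ Set.Ioo 0 θ, |ε * Y s| ≤ r) →
      |Y θ - ∫ s in (0 : ℝ)..θ, velocity b s 0| ≤ ρ * timeConst M := by
    intro θ hθ hθM hs
    rw [← hint θ hθ, ← intervalIntegral.integral_sub
      (intervalIntegrable_velocity_comp hb hK (Y := fun s ↦ ε * Y s) (by fun_prop) hθ)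
      (intervalIntegrable_velocity_zero hb hK hθ)]
    exact abs_integral_le_timeConst hρ hθ hθM fun s hs' ↦
      abs_velocity_sub_le hb hK hρ hr hs'.1 (hs'.2.le.trans hθM) (hs s hs')
  have hZ : ∀ θ, 0 ≤ θ → θ ≤ M → |∫ s in (0 : ℝ)..θ, velocity b s 0| ≤ K * timeConst M :=
    fun θ hθ hθM ↦ abs_integral_le_timeConst hK0 hθ hθM fun s hs' ↦
      abs_velocity_zero_le hb hK hs'.1 (hs'.2.le.trans hθM)
  refine hstep θ hθ hθM ?_
  by_contra! hcon
  obtain ⟨s₁, hs₁, hs₁r⟩ := hcon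
  have hcpt : IsCompact (Set.Icc 0 s₁ ∩ {s | r ≤ |ε * Y s|}) :=
    isCompact_Icc.inter_right (isClosed_le continuous_const (by fun_prop))
  -- At the first time `t` with `|ε Y| ≥ r`, `hstep` still applies and gives `|Y t| ≤ (K + ρ) *
  -- timeConst M`; then `hsmall` forces `|ε Y t| < r`, a contradiction.
  obtain ⟨t, ⟨⟨ht0, hts⟩, htr⟩, hmin⟩ := hcpt.exists_isLeast ⟨s₁, ⟨hs₁.1.le, le_rfl⟩, hs₁r.le⟩
  have htM : t ≤ M := hts.trans (hs₁.2.le.trans hθM)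
  have h1 := hstep t ht0 htM fun s hs ↦ by
    by_contra! hlt
    exact absurd (hmin ⟨⟨hs.1.le, hs.2.le.trans hts⟩, hlt.le⟩) (not_le.2 hs.2)
  have h2 := hZ t ht0 htM
  have h3 : |Y t| ≤ (K + ρ) * timeConst M := by
    have := abs_sub_abs_le_abs_sub (Y t) (∫ s in (0 : ℝ)..t, velocity b s 0)
    linarith
  have h4 : |ε * Y t| ≤ ε * ((K + ρ) * timeConst M) := by
    rw [abs_mul, abs_of_nonneg hε]
    gcongr
  have htr' : r ≤ |ε * Y t| := htr
  linarith

/-! ### Brownian scaling -/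

/-- Brownian scaling of an environment. -/
noncomputable def rescale (c : ℝ) (b : ℝ → ℝ) (y : ℝ) : ℝ := (√c)⁻¹ * b (c * y)

/-- This constant may blow up as `c → 0`. It only makes `velocity_eq` applicable; uniform bounds
come from equality in law. -/
lemma growth_rescale (hK : ∀ y, |b y| ≤ K * (1 + y ^ 2)) (c : ℝ) (y : ℝ) :
    |rescale c b y| ≤ (√c)⁻¹ * K * (1 + c ^ 2) * (1 + y ^ 2) := by
  have hK0 := nonneg_of_growth hK
  rw [rescale, abs_mul, abs_of_nonneg (inv_nonneg.2 (Real.sqrt_nonneg c))]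
  calc (√c)⁻¹ * |b (c * y)| ≤ (√c)⁻¹ * (K * (1 + (c * y) ^ 2)) := by gcongr; exact hK _
    _ ≤ (√c)⁻¹ * (K * ((1 + c ^ 2) * (1 + y ^ 2))) := by
      gcongr
      nlinarith [sq_nonneg c, sq_nonneg y]
    _ = _ := by ring

lemma velocity_rescale (hb : Continuous b) (hK : ∀ y, |b y| ≤ K * (1 + y ^ 2)) {c : ℝ}
    (hc : 0 < c) {s : ℝ} (hs : 0 < s) (x : ℝ) :
    velocity (rescale c b) s x = √c * velocity b (c ^ 2 * s) (c * x) := by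
  have hbr : Continuous (rescale c b) := by unfold rescale; fun_prop
  rw [velocity_eq hbr (growth_rescale hK c) hs, velocity_eq hb hK (by positivity),
    Real.sqrt_mul (sq_nonneg c), Real.sqrt_sq hc.le]
  have : ∀ z, profile z * rescale c b (x + √s * z) =
      (√c)⁻¹ * (profile z * b (c * x + c * √s * z)) := fun z ↦ by
    rw [rescale, show c * (x + √s * z) = c * x + c * √s * z by ring]
    ring
  simp_rw [this]
  rw [integral_const_mul]
  have h1 : 0 < √c := Real.sqrt_pos.2 hc
  have h3 : 0 < √s := Real.sqrt_pos.2 hs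
  have h2 : √c ^ 2 = c := Real.sq_sqrt hc.le
  field_simp
  rw [h2]

/-- The rescaled particle follows the rescaled environment with coupling `√c`. -/
lemma hasDerivAt_rescale (hb : Continuous b) (hK : ∀ y, |b y| ≤ K * (1 + y ^ 2)) {c : ℝ}
    (hc : 0 < c) {X : ℝ → ℝ} (hX : ∀ t, 0 < t → HasDerivAt X (velocity b t (X t)) t) {s : ℝ}
    (hs : 0 < s) :
    HasDerivAt (fun s ↦ X (c ^ 2 * s) / (c * √c))
      (velocity (rescale c b) s (√c * (X (c ^ 2 * s) / (c * √c)))) s := by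
  have h1 : 0 < √c := Real.sqrt_pos.2 hc
  have h2 : √c ^ 2 = c := Real.sq_sqrt hc.le
  have h := ((hX (c ^ 2 * s) (by positivity)).comp s
    ((hasDerivAt_id s).const_mul (c ^ 2))).div_const (c * √c)
  refine h.congr_deriv ?_
  rw [velocity_rescale hb hK hc hs, show c * (√c * (X (c ^ 2 * s) / (c * √c))) = X (c ^ 2 * s) by
    field_simp]
  field_simp
  rw [h2, mul_comm]

end Drift

/-! ### The velocity functional and its discretization -/

/-- The integrated velocity at the origin, as a functional of the environment. -/
noncomputable def velocityFunctional (θ : ℝ) (f : ℝ → ℝ) : ℝ :=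
  ∫ s in (0 : ℝ)..θ, (√s)⁻¹ * ∫ z, profile z * f (√s * z)

/-- The right side involves no derivative, so it also makes sense for step functions. -/
lemma integratedVelocity_eq {b : ℝ → ℝ} {K : ℝ} (hb : Continuous b)
    (hK : ∀ y, |b y| ≤ K * (1 + y ^ 2)) (θ : ℝ≥0) :
    integratedVelocity b θ = velocityFunctional θ b := by
  refine intervalIntegral.integral_congr_ae (ae_of_all _ fun s hs ↦ ?_)
  rw [Set.uIoc_of_le θ.coe_nonneg] at hs
  rw [velocity_eq hb hK hs.1]
  simp

section Functional

variable {f : ℝ → ℝ} {A : ℝ}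

lemma growth_sqrt_mul (hf : ∀ y, |f y| ≤ A * (1 + y ^ 2)) {s : ℝ} (hs : 0 ≤ s) (z : ℝ) :
    |f (√s * z)| ≤ A * (1 + s * z ^ 2) := by
  have := hf (√s * z)
  rwa [mul_pow, Real.sq_sqrt hs] at this

lemma integrable_profile_mul_comp (hfm : Measurable f) (hf : ∀ y, |f y| ≤ A * (1 + y ^ 2))
    {s : ℝ} (hs : 0 ≤ s) : Integrable fun z ↦ profile z * f (√s * z) := by
  have := continuous_profile.measurable
  exact (integrable_profile_mul.const_mul (A * (1 + s))).mono'
    (by fun_prop : Measurable fun z ↦ profile z * f (√s * z)).aestronglyMeasurable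
    (ae_of_all _ (profile_mul_bound (nonneg_of_growth hf) hs le_rfl (growth_sqrt_mul hf hs)))

lemma stronglyMeasurable_velocityFunctional (hfm : Measurable f) :
    StronglyMeasurable fun s ↦ (√s)⁻¹ * ∫ z, profile z * f (√s * z) := by
  have := continuous_profile.measurable
  refine (by fun_prop : Measurable fun s : ℝ ↦ (√s)⁻¹).stronglyMeasurable.mul ?_
  refine StronglyMeasurable.integral_prod_right'
    (f := fun p : ℝ × ℝ ↦ profile p.2 * f (√p.1 * p.2)) ?_
  exact Measurable.stronglyMeasurable (by fun_prop)

lemma norm_velocityFunctional_le (hf : ∀ y, |f y| ≤ A * (1 + y ^ 2)) {s θ : ℝ} (hs : 0 ≤ s)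
    (hsθ : s ≤ θ) : ‖(√s)⁻¹ * ∫ z, profile z * f (√s * z)‖ ≤
      (√s)⁻¹ * (A * (1 + θ) * profileMoment) := by
  rw [norm_mul, Real.norm_of_nonneg (inv_nonneg.2 (Real.sqrt_nonneg s)), Real.norm_eq_abs]
  gcongr
  exact abs_integral_profile_mul_le (nonneg_of_growth hf) hs hsθ (growth_sqrt_mul hf hs)

lemma intervalIntegrable_velocityFunctional (hfm : Measurable f)
    (hf : ∀ y, |f y| ≤ A * (1 + y ^ 2)) {θ : ℝ} (hθ : 0 ≤ θ) :
    IntervalIntegrable (fun s ↦ (√s)⁻¹ * ∫ z, profile z * f (√s * z)) volume 0 θ := by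
  refine ((intervalIntegrable_inv_sqrt hθ).mul_const (A * (1 + θ) * profileMoment)).mono_fun'
    (stronglyMeasurable_velocityFunctional hfm).aestronglyMeasurable ?_
  rw [Set.uIoc_of_le hθ]
  filter_upwards [ae_restrict_mem measurableSet_Ioc] with s hs
  exact norm_velocityFunctional_le hf hs.1.le hs.2

lemma velocityFunctional_sum {ι : Type*} (S : Finset ι) {g : ι → ℝ → ℝ} {A : ℝ}
    (hgm : ∀ i, Measurable (g i)) (hg : ∀ i y, |g i y| ≤ A * (1 + y ^ 2)) (a : ι → ℝ) {θ : ℝ}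
    (hθ : 0 ≤ θ) :
    velocityFunctional θ (fun y ↦ ∑ i ∈ S, a i * g i y) =
      ∑ i ∈ S, a i * velocityFunctional θ (g i) := by
  simp only [velocityFunctional, ← intervalIntegral.integral_const_mul]
  rw [← intervalIntegral.integral_finsetSum fun i _ ↦
    (intervalIntegrable_velocityFunctional (hgm i) (hg i) hθ).const_mul (a i)]
  refine intervalIntegral.integral_congr fun s hs ↦ ?_
  rw [Set.uIcc_of_le hθ] at hs
  simp only [Finset.mul_sum]
  rw [integral_finsetSum]
  · rw [Finset.mul_sum]
    refine Finset.sum_congr rfl fun i _ ↦ ?_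
    simp_rw [mul_left_comm (profile _), integral_const_mul]
    ring
  · intro i _
    simp_rw [mul_left_comm]
    exact (integrable_profile_mul_comp (hgm i) (hg i) hs.1).const_mul (a i)

/-- Dominated convergence is applied in space and then in time; a common quadratic growth constant
supplies both dominating functions. -/
lemma tendsto_velocityFunctional {g : ℕ → ℝ → ℝ} (hgm : ∀ n, Measurable (g n))
    (hg : ∀ n y, |g n y| ≤ A * (1 + y ^ 2))
    (hlim : ∀ y, Tendsto (fun n ↦ g n y) atTop (𝓝 (f y))) {θ : ℝ} (hθ : 0 ≤ θ) :
    Tendsto (fun n ↦ velocityFunctional θ (g n)) atTop (𝓝 (velocityFunctional θ f)) := by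
  refine intervalIntegral.tendsto_integral_filter_of_dominated_convergence
    (fun s ↦ (√s)⁻¹ * (A * (1 + θ) * profileMoment))
    (Eventually.of_forall fun n ↦
      (stronglyMeasurable_velocityFunctional (hgm n)).aestronglyMeasurable)
    (Eventually.of_forall fun n ↦ ae_of_all _ fun s hs ↦ ?_)
    ((intervalIntegrable_inv_sqrt hθ).mul_const _) (ae_of_all _ fun s hs ↦ ?_)
  · rw [Set.uIoc_of_le hθ] at hs
    exact norm_velocityFunctional_le (hg n) hs.1.le hs.2
  · rw [Set.uIoc_of_le hθ] at hs
    refine Tendsto.const_mul _ (tendsto_integral_of_dominated_convergence _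
      (fun n ↦ (integrable_profile_mul_comp (hgm n) (hg n) hs.1.le).aestronglyMeasurable)
      (integrable_profile_mul.const_mul (A * (1 + s))) (fun n ↦ ae_of_all _
        (profile_mul_bound (nonneg_of_growth (hg n)) hs.1.le le_rfl
          (growth_sqrt_mul (hg n) hs.1.le)))
      (ae_of_all _ fun z ↦ (hlim _).const_mul _))

end Functional

/-- The cell `[k / n, (k + 1) / n)`, as an indicator function. -/
noncomputable def cellIndicator (n : ℕ) (k : ℤ) (y : ℝ) : ℝ := if ⌊(n : ℝ) * y⌋ = k then 1 else 0

/-- The discretization of `b` on a grid of mesh `1 / n`, truncated at distance `n`. -/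
noncomputable def discretize (n : ℕ) (b : ℝ → ℝ) (y : ℝ) : ℝ :=
  ∑ k ∈ Finset.Icc (-(n ^ 2 : ℤ)) (n ^ 2), b (k / n) * cellIndicator n k y

lemma measurable_cellIndicator (n : ℕ) (k : ℤ) : Measurable (cellIndicator n k) := by
  refine Measurable.ite ?_ measurable_const measurable_const
  exact (Int.measurable_floor.comp (measurable_const.mul measurable_id)) (measurableSet_singleton k)

lemma abs_cellIndicator_le (n : ℕ) (k : ℤ) (y : ℝ) : |cellIndicator n k y| ≤ 1 * (1 + y ^ 2) := by
  unfold cellIndicator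
  split_ifs
  · simpa using sq_nonneg y
  · simpa using (by positivity : 0 ≤ 1 + y ^ 2)

lemma measurable_discretize (n : ℕ) (b : ℝ → ℝ) : Measurable (discretize n b) := by
  unfold discretize
  have := measurable_cellIndicator n
  fun_prop

lemma discretize_eq (n : ℕ) (b : ℝ → ℝ) (y : ℝ) : discretize n b y =
    if ⌊(n : ℝ) * y⌋ ∈ Finset.Icc (-(n ^ 2 : ℤ)) (n ^ 2) then b (⌊(n : ℝ) * y⌋ / n) else 0 := by
  simp [discretize, cellIndicator]

lemma abs_floor_div_sub_le {n : ℕ} (hn : 0 < n) (y : ℝ) : |(⌊(n : ℝ) * y⌋ : ℝ) / n - y| ≤ 1 / n := by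
  have hn' : (0 : ℝ) < n := by exact_mod_cast hn
  have h : (⌊(n : ℝ) * y⌋ : ℝ) / n - y = (⌊(n : ℝ) * y⌋ - n * y) / n := by field_simp
  rw [h, abs_div, abs_of_pos hn']
  gcongr
  rw [abs_le]
  constructor <;> linarith [Int.floor_le ((n : ℝ) * y), Int.lt_floor_add_one ((n : ℝ) * y)]

lemma abs_discretize_le {b : ℝ → ℝ} {K : ℝ} (hK : ∀ y, |b y| ≤ K * (1 + y ^ 2)) {n : ℕ}
    (hn : 0 < n) (y : ℝ) : |discretize n b y| ≤ 4 * K * (1 + y ^ 2) := by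
  have hK0 := nonneg_of_growth hK
  rw [discretize_eq]
  split_ifs
  · have h1 : |(⌊(n : ℝ) * y⌋ : ℝ) / n - y| ≤ 1 := (abs_floor_div_sub_le hn y).trans
      (div_le_one_of_le₀ (by exact_mod_cast hn) (by positivity))
    have h2 := one_add_add_sq_le ((⌊(n : ℝ) * y⌋ : ℝ) / n - y) y
    rw [sub_add_cancel] at h2
    have h3 : ((⌊(n : ℝ) * y⌋ : ℝ) / n - y) ^ 2 ≤ 1 := by
      rw [← sq_abs]
      exact pow_le_one₀ (abs_nonneg _) h1
    calc _ ≤ K * (1 + ((⌊(n : ℝ) * y⌋ : ℝ) / n) ^ 2) := hK _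
      _ ≤ K * (2 * (1 + 1) * (1 + y ^ 2)) := by
        gcongr
        exact h2.trans (by gcongr)
      _ = _ := by ring
  · rw [abs_zero]
    positivity

lemma tendsto_discretize {b : ℝ → ℝ} (hb : Continuous b) (y : ℝ) :
    Tendsto (fun n ↦ discretize n b y) atTop (𝓝 (b y)) := by
  have h1 : Tendsto (fun n : ℕ ↦ (⌊(n : ℝ) * y⌋ : ℝ) / n) atTop (𝓝 y) := by
    rw [tendsto_iff_dist_tendsto_zero]
    refine squeeze_zero' (Eventually.of_forall fun _ ↦ dist_nonneg) ?_
      tendsto_one_div_atTop_nhds_zero_nat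
    filter_upwards [eventually_gt_atTop 0] with n hn
    exact abs_floor_div_sub_le hn y
  refine ((hb.tendsto y).comp h1).congr' ?_
  obtain ⟨N, hN⟩ := exists_nat_ge (|y| + 1)
  filter_upwards [eventually_ge_atTop N, eventually_gt_atTop 0] with n hn hn0
  rw [discretize_eq, if_pos, Function.comp_apply]
  have hnN : |y| + 1 ≤ n := hN.trans (by exact_mod_cast hn)
  have hn1 : (1 : ℝ) ≤ n := by exact_mod_cast hn0
  have hy := abs_le.1 (le_refl |y|)
  have ha : (n : ℝ) * |y| + n ≤ n ^ 2 := by nlinarith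
  rw [Finset.mem_Icc]
  constructor
  · rw [Int.le_floor]
    push_cast
    nlinarith
  · have : (⌊(n : ℝ) * y⌋ : ℝ) ≤ n ^ 2 := by
      refine (Int.floor_le _).trans ?_
      nlinarith
    exact_mod_cast this

/-! ### Tame environments -/

/-- The function on the line whose right and left halves are the components of `q`. -/
noncomputable def glue (q : C(ℝ≥0, ℝ) × C(ℝ≥0, ℝ)) (x : ℝ) : ℝ :=
  q.1 x.toNNReal + q.2 (-x).toNNReal

lemma continuous_glue_uncurry :
    Continuous fun p : (C(ℝ≥0, ℝ) × C(ℝ≥0, ℝ)) × ℝ ↦ glue p.1 p.2 := by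
  have h1 : Continuous fun x : ℝ ↦ x.toNNReal := continuous_real_toNNReal
  unfold glue
  fun_prop

lemma continuous_glue (q : C(ℝ≥0, ℝ) × C(ℝ≥0, ℝ)) : Continuous (glue q) :=
  continuous_glue_uncurry.comp (by fun_prop : Continuous fun x : ℝ ↦ (q, x))

lemma continuous_glue_eval (x : ℝ) : Continuous fun q ↦ glue q x :=
  continuous_glue_uncurry.comp (by fun_prop : Continuous fun q ↦ (q, x))

/-- Environments of at most linear growth. -/
def linearGrowth : Set (C(ℝ≥0, ℝ) × C(ℝ≥0, ℝ)) := {q | ∃ K : ℕ, ∀ y, |glue q y| ≤ K * (1 + |y|)}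

/-- Environments with quantitative growth and modulus of continuity. -/
def tame (K r ρ : ℝ) : Set (C(ℝ≥0, ℝ) × C(ℝ≥0, ℝ)) :=
  {q | (∀ y, |glue q y| ≤ K * (1 + y ^ 2)) ∧
    ∀ y h, |h| ≤ r → |glue q (h + y) - glue q y| ≤ ρ * (1 + y ^ 2)}

lemma measurableSet_linearGrowth : MeasurableSet linearGrowth := by
  have : linearGrowth = ⋃ K : ℕ, ⋂ y : ℝ, {q | |glue q y| ≤ K * (1 + |y|)} := by
    ext
    simp [linearGrowth]
  rw [this]
  refine .iUnion fun K ↦ IsClosed.measurableSet (isClosed_iInter fun y ↦ ?_)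
  exact isClosed_le (continuous_glue_eval y).abs continuous_const

lemma measurableSet_tame (K r ρ : ℝ) : MeasurableSet (tame K r ρ) := by
  refine IsClosed.measurableSet ?_
  have : tame K r ρ = (⋂ y : ℝ, {q | |glue q y| ≤ K * (1 + y ^ 2)}) ∩
      ⋂ (y : ℝ) (h : ℝ) (_ : |h| ≤ r),
        {q | |glue q (h + y) - glue q y| ≤ ρ * (1 + y ^ 2)} := by
    ext
    simp [tame]
  rw [this]
  refine (isClosed_iInter fun y ↦ isClosed_le (continuous_glue_eval y).abs continuous_const).inter
    (isClosed_iInter fun y ↦ isClosed_iInter fun h ↦ isClosed_iInter fun _ ↦ ?_)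
  exact isClosed_le ((continuous_glue_eval _).sub (continuous_glue_eval _)).abs continuous_const

lemma quadratic_of_linear {b : ℝ → ℝ} {K : ℝ} (hK0 : 0 ≤ K) (h : ∀ y, |b y| ≤ K * (1 + |y|))
    (y : ℝ) : |b y| ≤ 2 * K * (1 + y ^ 2) := by
  refine (h y).trans ?_
  rw [mul_comm 2 K, mul_assoc]
  gcongr
  nlinarith [abs_le_one_add_sq y, sq_nonneg y]

lemma exists_growth {q : C(ℝ≥0, ℝ) × C(ℝ≥0, ℝ)} (hq : q ∈ linearGrowth) :
    ∃ K : ℝ, ∀ y, |glue q y| ≤ K * (1 + y ^ 2) := by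
  obtain ⟨K, hK⟩ := hq
  exact ⟨2 * K, quadratic_of_linear K.cast_nonneg hK⟩

lemma tame_mono {K K' r r' ρ : ℝ} (hK : K ≤ K') (hr : r' ≤ r) : tame K r ρ ⊆ tame K' r' ρ := by
  rintro q ⟨h1, h2⟩
  exact ⟨fun y ↦ (h1 y).trans (by gcongr), fun y h hh ↦ h2 y h (hh.trans hr)⟩

/-- Environments of linear growth are tame. -/
lemma exists_mem_tame {q : C(ℝ≥0, ℝ) × C(ℝ≥0, ℝ)} (hq : q ∈ linearGrowth) {ρ : ℝ} (hρ : 0 < ρ) :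
    ∃ n : ℕ, q ∈ tame n (1 / (n + 1)) ρ := by
  obtain ⟨K, hK⟩ := hq
  have hK0 : (0 : ℝ) ≤ K := K.cast_nonneg
  -- For `|y| > R ≥ 1`, linear growth bounds the increment by `K (3 + 2|y|) ≤ 5K|y| ≤ ρ y²`. For
  -- `|y| ≤ R`, uniform continuity on a compact interval is used.
  set R : ℝ := 1 + 5 * K / ρ with hR
  have hR1 : 1 ≤ R := by
    rw [hR]
    have : 0 ≤ 5 * K / ρ := by positivity
    linarith
  have hRK : 5 * K ≤ ρ * R := by
    rw [hR, mul_add, mul_div_cancel₀ _ hρ.ne']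
    linarith
  have huc := (isCompact_Icc (a := -(R + 1)) (b := R + 1)).uniformContinuousOn_of_continuous
    (continuous_glue q).continuousOn
  obtain ⟨δ, hδ, hδq⟩ := Metric.uniformContinuousOn_iff.1 huc ρ hρ
  obtain ⟨m, hm⟩ := exists_nat_one_div_lt hδ
  refine ⟨max (2 * K) m, fun y ↦ ?_, fun y h hh ↦ ?_⟩
  · refine (quadratic_of_linear hK0 hK y).trans ?_
    gcongr
    exact_mod_cast le_max_left (2 * K) _
  · have hh1 : |h| ≤ 1 := hh.trans (div_le_one_of_le₀ (by simp) (by positivity))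
    have hhδ : |h| < δ := by
      refine hh.trans_lt (lt_of_le_of_lt ?_ hm)
      gcongr
      simp
    rcases le_or_gt |y| R with hy | hy
    · have h1 := abs_le.1 hy
      have h2 := abs_le.1 hh1
      have := hδq (h + y) ⟨by linarith, by linarith⟩ y ⟨by linarith, by linarith⟩
        (by simpa [Real.dist_eq] using hhδ)
      rw [Real.dist_eq] at this
      nlinarith [mul_nonneg hρ.le (sq_nonneg y)]
    · have h1 : |h + y| ≤ 1 + |y| := (abs_add_le h y).trans (by linarith)
      have h2 := hK (h + y)
      have h3 := hK y
      have h4 := abs_sub (glue q (h + y)) (glue q y)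
      have h5 : (K : ℝ) * (1 + |h + y|) ≤ K * (2 + |y|) :=
        mul_le_mul_of_nonneg_left (by linarith) hK0
      have h6 : |glue q (h + y) - glue q y| ≤ K * (5 * |y|) := by
        have : (K : ℝ) * (3 + 2 * |y|) ≤ K * (5 * |y|) :=
          mul_le_mul_of_nonneg_left (by linarith) hK0
        linarith
      have h7 : ρ * R * |y| ≤ ρ * |y| * |y| := by
        nlinarith [mul_le_mul_of_nonneg_left hy.le (mul_nonneg hρ.le (abs_nonneg y))]
      nlinarith [abs_mul_abs_self y, mul_le_mul_of_nonneg_right hRK (abs_nonneg y)]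

open Classical in
/-- The path of the integrated velocity at the origin, as a functional of the environment. -/
noncomputable def velocityPath (q : C(ℝ≥0, ℝ) × C(ℝ≥0, ℝ)) : C(ℝ≥0, ℝ) :=
  if q ∈ linearGrowth then toPath (integratedVelocity (glue q)) else 0

lemma velocityPath_apply {q : C(ℝ≥0, ℝ) × C(ℝ≥0, ℝ)} (hq : q ∈ linearGrowth) (θ : ℝ≥0) :
    velocityPath q θ = integratedVelocity (glue q) θ := by
  obtain ⟨K, hK⟩ := exists_growth hq
  rw [velocityPath, if_pos hq,
    toPath_apply (continuous_integratedVelocity (continuous_glue q) hK)]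

/-- Evaluations suffice. On the growth event each is an iterated integral whose integrand is jointly
measurable, because `glue` is jointly continuous in environment and position. -/
lemma measurable_velocityPath : Measurable velocityPath := by
  refine measurable_path_of_eval fun θ ↦ ?_
  have heq : (fun q ↦ velocityPath q θ) =
      linearGrowth.indicator fun q ↦ velocityFunctional θ (glue q) := by
    ext q
    by_cases hq : q ∈ linearGrowth
    · obtain ⟨K, hK⟩ := exists_growth hq
      rw [velocityPath_apply hq, Set.indicator_of_mem hq,
        integratedVelocity_eq (continuous_glue q) hK]
    · simp [velocityPath, hq]
  rw [heq]
  refine StronglyMeasurable.measurable ?_ |>.indicator measurableSet_linearGrowth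
  simp only [velocityFunctional, intervalIntegral.integral_of_le θ.coe_nonneg]
  refine StronglyMeasurable.integral_prod_right'
    (f := fun p : (C(ℝ≥0, ℝ) × C(ℝ≥0, ℝ)) × ℝ ↦
      (√p.2)⁻¹ * ∫ z, profile z * glue p.1 (√p.2 * z)) ?_
  refine (by fun_prop : Measurable fun p : (C(ℝ≥0, ℝ) × C(ℝ≥0, ℝ)) × ℝ ↦
    (√p.2)⁻¹).stronglyMeasurable.mul ?_
  refine StronglyMeasurable.integral_prod_right'
    (f := fun p : ((C(ℝ≥0, ℝ) × C(ℝ≥0, ℝ)) × ℝ) × ℝ ↦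
      profile p.2 * glue p.1.1 (√p.1.2 * p.2)) ?_
  have h1 := continuous_profile
  have h2 : Continuous fun p : ((C(ℝ≥0, ℝ) × C(ℝ≥0, ℝ)) × ℝ) × ℝ ↦
      glue p.1.1 (√p.1.2 * p.2) :=
    continuous_glue_uncurry.comp (by fun_prop :
      Continuous fun p : ((C(ℝ≥0, ℝ) × C(ℝ≥0, ℝ)) × ℝ) × ℝ ↦ (p.1.1, √p.1.2 * p.2))
  exact Continuous.stronglyMeasurable (by fun_prop)

/-! ### The Brownian environment and Gaussianity -/

section

variable {Ω : Type*} [MeasurableSpace Ω] {P : Measure Ω} {B : ℝ → Ω → ℝ}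

/-- The right and left halves of an environment, as a random element of the path space. -/
noncomputable def pathPair (B : ℝ → Ω → ℝ) (ω : Ω) : C(ℝ≥0, ℝ) × C(ℝ≥0, ℝ) :=
  (toPath fun x ↦ B x ω, toPath fun x ↦ B (-(x : ℝ)) ω)

lemma aemeasurable_pathPair (hB : IsTwoSidedBrownian B P) : AEMeasurable (pathPair B) P :=
  (aemeasurable_toPath hB.right.aemeasurable hB.right.cont).prodMk
    (aemeasurable_toPath hB.left.aemeasurable hB.left.cont)

/-- At each point one of the two halves is evaluated at `0`, where `B` vanishes almost surely. -/
lemma ae_glue_pathPair (hB : IsTwoSidedBrownian B P) :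
    ∀ᵐ ω ∂P, glue (pathPair B ω) = fun x ↦ B x ω := by
  filter_upwards [hB.right.cont, hB.left.cont, hB.right.eval_zero_ae_eq_zero] with ω h1 h2 h0
  rw [NNReal.coe_zero] at h0
  ext x
  rw [glue, pathPair, toPath_apply h1, toPath_apply h2]
  rcases le_total 0 x with hx | hx
  · rw [Real.toNNReal_of_nonpos (neg_nonpos.2 hx), Real.coe_toNNReal x hx]
    simp [h0]
  · rw [Real.toNNReal_of_nonpos hx, Real.coe_toNNReal (-x) (neg_nonneg.2 hx)]
    simp [h0]

lemma ae_pathPair_mem_linearGrowth [IsProbabilityMeasure P] (hB : IsTwoSidedBrownian B P) :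
    ∀ᵐ ω ∂P, pathPair B ω ∈ linearGrowth := by
  filter_upwards [ae_linear_growth_of_brownian hB.right, ae_linear_growth_of_brownian hB.left,
    ae_glue_pathPair hB] with ω ⟨K₁, h1⟩ ⟨K₂, h2⟩ hg
  obtain ⟨K, hK⟩ := exists_nat_ge (max K₁ K₂)
  refine ⟨K, fun y ↦ ?_⟩
  rw [hg]
  rcases le_total 0 y with hy | hy
  · have := h1 y.toNNReal
    rw [Real.coe_toNNReal y hy] at this
    rw [abs_of_nonneg hy]
    exact this.trans (by gcongr; exact (le_max_left _ _).trans hK)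
  · have := h2 (-y).toNNReal
    rw [Real.coe_toNNReal (-y) (neg_nonneg.2 hy), neg_neg] at this
    rw [abs_of_nonpos hy]
    refine this.trans (mul_le_mul_of_nonneg_right ((le_max_right _ _).trans hK) (by linarith))

/-- Almost surely the environment is continuous and of quadratic growth. -/
lemma ae_regular [IsProbabilityMeasure P] (hB : IsTwoSidedBrownian B P) :
    ∀ᵐ ω ∂P, Continuous (fun x ↦ B x ω) ∧ ∃ K : ℝ, ∀ y, |B y ω| ≤ K * (1 + y ^ 2) := by
  filter_upwards [ae_glue_pathPair hB, ae_pathPair_mem_linearGrowth hB] with ω hg hl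
  obtain ⟨K, hK⟩ := exists_growth hl
  rw [hg] at hK
  exact ⟨hg ▸ continuous_glue _, K, hK⟩

/-- Independence makes the joint law a product, and each factor is the unique Brownian law on path
space. -/
lemma map_pathPair_eq [IsProbabilityMeasure P] {B' : ℝ → Ω → ℝ} (hB : IsTwoSidedBrownian B P)
    (hB' : IsTwoSidedBrownian B' P) : P.map (pathPair B) = P.map (pathPair B') := by
  have key : ∀ {A : ℝ → Ω → ℝ}, IsTwoSidedBrownian A P → P.map (pathPair A) =
      (P.map fun ω ↦ toPath fun x : ℝ≥0 ↦ A x ω).prod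
        (P.map fun ω ↦ toPath fun x : ℝ≥0 ↦ A (-(x : ℝ)) ω) := fun {A} hA ↦
    (indepFun_iff_map_prod_eq_prod_map_map
      (aemeasurable_toPath hA.right.aemeasurable hA.right.cont)
      (aemeasurable_toPath hA.left.aemeasurable hA.left.cont)).1
      (indepFun_toPath hA.right.cont hA.left.cont hA.indep)
  rw [key hB, key hB', map_toPath_eq_of_brownian hB.right hB'.right,
    map_toPath_eq_of_brownian hB.left hB'.left]

/-- Brownian scaling of a two-sided Brownian motion. -/
lemma isTwoSidedBrownian_rescale (hB : IsTwoSidedBrownian B P) {c : ℝ≥0} (hc : c ≠ 0) :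
    IsTwoSidedBrownian (fun x ω ↦ rescale c (fun y ↦ B y ω) x) P where
  right := by simpa [rescale] using hB.right.smul hc
  left := by simpa [rescale] using hB.left.smul hc
  indep := by
    have hφ : Measurable fun (f : ℝ≥0 → ℝ) (x : ℝ≥0) ↦ (√c)⁻¹ * f (c * x) :=
      measurable_pi_lambda _ fun x ↦ measurable_const.mul (measurable_pi_apply _)
    simpa [rescale, Function.comp_def] using hB.indep.comp hφ hφ

/-- Finitely many values of `B` form a linear image of values of the two independent Gaussian
halves. -/
lemma isGaussianProcess_environment [IsProbabilityMeasure P] (hB : IsTwoSidedBrownian B P) :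
    IsGaussianProcess B P where
  hasGaussianLaw I := by
    classical
    set J := I.image Real.toNNReal
    set J' := I.image fun x : ℝ ↦ (-x).toNNReal
    have hind : IndepFun (fun ω ↦ J.restrict fun x : ℝ≥0 ↦ B x ω)
        (fun ω ↦ J'.restrict fun x : ℝ≥0 ↦ B (-(x : ℝ)) ω) P :=
      hB.indep.comp (Finset.measurable_restrict J) (Finset.measurable_restrict J')
    have hpair := hind.hasGaussianLaw (hB.right.isGaussianProcess.hasGaussianLaw J)
      (hB.left.isGaussianProcess.hasGaussianLaw J')
    let L : (J → ℝ) × (J' → ℝ) →L[ℝ] (I → ℝ) := ContinuousLinearMap.pi fun i ↦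
      (ContinuousLinearMap.proj (R := ℝ) (φ := fun _ : J ↦ ℝ)
        ⟨(i : ℝ).toNNReal, Finset.mem_image_of_mem _ i.2⟩).comp (ContinuousLinearMap.fst ℝ _ _) +
      (ContinuousLinearMap.proj (R := ℝ) (φ := fun _ : J' ↦ ℝ)
        ⟨(-(i : ℝ)).toNNReal, Finset.mem_image_of_mem (fun x : ℝ ↦ (-x).toNNReal) i.2⟩).comp
        (ContinuousLinearMap.snd ℝ _ _)
    refine (hpair.map_fun L).congr ?_
    filter_upwards [ae_glue_pathPair hB, hB.right.cont, hB.left.cont] with ω hg h1 h2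
    ext i
    rw [Finset.restrict, ← congrFun hg i, glue, pathPair, toPath_apply h1, toPath_apply h2]
    rfl

lemma integral_environment [IsProbabilityMeasure P] (hB : IsTwoSidedBrownian B P) (x : ℝ) :
    ∫ ω, B x ω ∂P = 0 := by
  rcases le_total 0 x with hx | hx
  · simpa [Real.coe_toNNReal x hx] using hB.right.integral_eval x.toNNReal
  · simpa [Real.coe_toNNReal (-x) (neg_nonneg.2 hx)] using hB.left.integral_eval (-x).toNNReal

lemma hasGaussianLaw_pi_of_dual [IsProbabilityMeasure P] {ι : Type*} [Fintype ι] {X : Ω → ι → ℝ}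
    (hX : AEMeasurable X P)
    (h : ∀ L : (ι → ℝ) →L[ℝ] ℝ, HasGaussianLaw (fun ω ↦ L (X ω)) P) : HasGaussianLaw X P where
  isGaussian_map := ⟨fun L ↦ by
    rw [AEMeasurable.map_map_of_aemeasurable L.continuous.measurable.aemeasurable hX,
      integral_map hX L.continuous.aestronglyMeasurable,
      variance_map L.continuous.measurable.aemeasurable hX]
    exact (h L).map_eq_gaussianReal⟩

/-- The approximation of the integrated velocity by finite sums of values of the environment. -/
noncomputable def velocitySum (B : ℝ → Ω → ℝ) (n : ℕ) (θ : ℝ≥0) (ω : Ω) : ℝ :=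
  velocityFunctional θ (discretize (n + 1) fun x ↦ B x ω)

/-- The weights are deterministic, so Gaussianity and zero mean pass from `B` to the sum. The index
`n + 1` avoids a mesh of `1 / 0`. -/
lemma velocitySum_eq {Ω : Type*} (B : ℝ → Ω → ℝ) (n : ℕ) (θ : ℝ≥0) (ω : Ω) :
    velocitySum B n θ ω = ∑ k ∈ Finset.Icc (-((n + 1 : ℕ) ^ 2 : ℤ)) ((n + 1 : ℕ) ^ 2),
      B (k / (n + 1 : ℕ)) ω * velocityFunctional θ (cellIndicator (n + 1) k) :=
  velocityFunctional_sum _ (measurable_cellIndicator (n + 1)) (abs_cellIndicator_le (n + 1)) _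
    θ.coe_nonneg

lemma isGaussianProcess_velocitySum [IsProbabilityMeasure P] (hB : IsTwoSidedBrownian B P)
    (n : ℕ) : IsGaussianProcess (velocitySum B n) P := by
  classical
  refine IsGaussianProcess.of_isGaussianProcess (isGaussianProcess_environment hB) fun θ ↦ ?_
  set S := Finset.Icc (-((n + 1 : ℕ) ^ 2 : ℤ)) ((n + 1 : ℕ) ^ 2)
  refine ⟨S.image fun k : ℤ ↦ (k / (n + 1 : ℕ) : ℝ), ∑ k ∈ S.attach,
    velocityFunctional θ (cellIndicator (n + 1) k) • ContinuousLinearMap.proj (R := ℝ)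
      (φ := fun _ : ↥(S.image fun k : ℤ ↦ (k / (n + 1 : ℕ) : ℝ)) ↦ ℝ)
      ⟨((k : ℤ) / (n + 1 : ℕ) : ℝ), Finset.mem_image_of_mem _ k.2⟩, fun ω ↦ ?_⟩
  rw [velocitySum_eq, ← Finset.sum_attach]
  simp [S, mul_comm]

lemma integral_velocitySum [IsProbabilityMeasure P] (hB : IsTwoSidedBrownian B P) (n : ℕ)
    (θ : ℝ≥0) : ∫ ω, velocitySum B n θ ω ∂P = 0 := by
  simp_rw [velocitySum_eq]
  rw [integral_finsetSum _ fun k _ ↦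
    ((isGaussianProcess_environment hB).hasGaussianLaw_eval _).integrable.mul_const _]
  simp [integral_mul_const, integral_environment hB]

lemma ae_tendsto_velocitySum [IsProbabilityMeasure P] (hB : IsTwoSidedBrownian B P) :
    ∀ᵐ ω ∂P, ∀ θ, Tendsto (fun n ↦ velocitySum B n θ ω) atTop
      (𝓝 (integratedVelocity (fun x ↦ B x ω) θ)) := by
  filter_upwards [ae_regular hB] with ω ⟨hc, K, hK⟩ θ
  rw [integratedVelocity_eq hc hK]
  exact tendsto_velocityFunctional (A := 4 * K) (fun n ↦ measurable_discretize _ _)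
    (fun n ↦ abs_discretize_le hK n.succ_pos)
    (fun y ↦ (tendsto_discretize hc y).comp (tendsto_add_atTop_nat 1)) θ.coe_nonneg

/-- The integrated velocity at the origin is jointly Gaussian in time. -/
lemma isGaussianProcess_integratedVelocity [IsProbabilityMeasure P]
    (hB : IsTwoSidedBrownian B P) :
    IsGaussianProcess (fun (θ : ℝ≥0) ω ↦ integratedVelocity (fun x ↦ B x ω) θ) P where
  hasGaussianLaw I := by
    have hlim := ae_tendsto_velocitySum hB
    have hS := fun n ↦ (isGaussianProcess_velocitySum hB n).hasGaussianLaw I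
    have hm : AEMeasurable
        (fun ω ↦ I.restrict fun θ : ℝ≥0 ↦ integratedVelocity (fun x ↦ B x ω) θ) P := by
      refine aemeasurable_pi_lambda _ fun θ ↦ ?_
      exact aemeasurable_of_tendsto_metrizable_ae'
        (fun n ↦ (isGaussianProcess_velocitySum hB n).aemeasurable θ) (hlim.mono fun ω h ↦ h θ)
    refine hasGaussianLaw_pi_of_dual hm fun L ↦ ?_
    refine hasGaussianLaw_of_ae_tendsto (fun n ↦ (hS n).map_fun L) (fun n ↦ ?_) ?_
    · rw [ContinuousLinearMap.integral_comp_comm L (hS n).integrable]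
      have : ∫ ω, I.restrict (velocitySum B n · ω) ∂P = 0 := by
        ext i
        rw [eval_integral fun i ↦ ((hS n).eval i).integrable]
        exact integral_velocitySum hB n i
      rw [this, map_zero]
    · filter_upwards [hlim] with ω h
      exact (L.continuous.tendsto _).comp (tendsto_pi_nhds.2 fun i ↦ h i)

end

/-! ### Comparison in probability -/

section

variable {Ω : Type*} [MeasurableSpace Ω] {P : Measure Ω} [IsProbabilityMeasure P] {B : ℝ → Ω → ℝ}

lemma ae_velocityPath_eq (hB : IsTwoSidedBrownian B P) :
    (fun ω ↦ velocityPath (pathPair B ω)) =ᵐ[P]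
      fun ω ↦ toPath (fun θ : ℝ≥0 ↦ integratedVelocity (fun x ↦ B x ω) θ) := by
  filter_upwards [ae_glue_pathPair hB, ae_pathPair_mem_linearGrowth hB] with ω hg hl
  rw [velocityPath, if_pos hl, hg]

/-- The tame sets increase with `n` and cover the environments of linear growth. As the statement
concerns only the law, one `n` serves every rescaled environment. -/
lemma exists_measure_tame_compl_lt (hB : IsTwoSidedBrownian B P) {ρ κ : ℝ} (hρ : 0 < ρ)
    (hκ : 0 < κ) : ∃ n : ℕ, (P.map (pathPair B)).real (tame n (1 / (n + 1)) ρ)ᶜ < κ := by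
  have hm := aemeasurable_pathPair hB
  have : IsProbabilityMeasure (P.map (pathPair B)) := Measure.isProbabilityMeasure_map hm
  have hanti : Antitone fun n : ℕ ↦ (tame n (1 / ((n : ℝ) + 1)) ρ)ᶜ := fun n m hnm ↦
    Set.compl_subset_compl.2 (tame_mono (by exact_mod_cast hnm) (by gcongr))
  have hnull : P.map (pathPair B) (⋂ n : ℕ, (tame n (1 / ((n : ℝ) + 1)) ρ)ᶜ) = 0 := by
    have hl : ∀ᵐ q ∂(P.map (pathPair B)), q ∈ linearGrowth :=
      (ae_map_iff hm measurableSet_linearGrowth).2 (ae_pathPair_mem_linearGrowth hB)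
    refine measure_eq_zero_iff_ae_notMem.2 (hl.mono fun q hql hq ↦ ?_)
    obtain ⟨n, hn⟩ := exists_mem_tame hql hρ
    exact Set.mem_iInter.1 hq n hn
  have h := tendsto_measure_iInter_atTop (μ := P.map (pathPair B))
    (fun n ↦ (measurableSet_tame _ _ _).compl.nullMeasurableSet) hanti ⟨0, measure_ne_top _ _⟩
  rw [hnull] at h
  have h' := (ENNReal.tendsto_toReal ENNReal.zero_ne_top).comp h
  rw [ENNReal.toReal_zero] at h'
  exact (h'.eventually_lt_const hκ).exists

/-- In a tame environment, the rescaled particle is close to the rescaled integrated velocity. -/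
lemma abs_rescaled_sub_le {b : ℝ → ℝ} {K : ℝ} (hb : Continuous b)
    (hK : ∀ y, |b y| ≤ K * (1 + y ^ 2)) {X : ℝ≥0 → ℝ} (hX0 : X 0 = 0) (hXc : Continuous X)
    (hX : ∀ t : ℝ, 0 < t →
      HasDerivAt (fun s : ℝ ↦ X s.toNNReal) (velocity b t (X t.toNNReal)) t)
    {c : ℝ} (hc : 0 < c) {K' r ρ M : ℝ} (hρ : 0 ≤ ρ)
    (hK' : ∀ y, |rescale c b y| ≤ K' * (1 + y ^ 2))
    (hr : ∀ y h, |h| ≤ r → |rescale c b (h + y) - rescale c b y| ≤ ρ * (1 + y ^ 2))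
    (hsmall : √c * ((K' + ρ) * timeConst M) < r) {T θ : ℝ≥0} (hT : (T : ℝ) = c ^ 2)
    (hθ : (θ : ℝ) ≤ M) :
    |X (θ * T) / (T : ℝ) ^ (3 / 4 : ℝ) - integratedVelocity (rescale c b) θ| ≤
      ρ * timeConst M := by
  have hpow : (T : ℝ) ^ (3 / 4 : ℝ) = c * √c := by
    rw [hT, ← Real.rpow_natCast, ← Real.rpow_mul hc.le, Real.sqrt_eq_rpow]
    nth_rewrite 2 [← Real.rpow_one c]
    rw [← Real.rpow_add hc]
    norm_num
  have hcont : Continuous fun s : ℝ ↦ X s.toNNReal := hXc.comp continuous_real_toNNReal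
  have hbr : Continuous (rescale c b) := by unfold rescale; fun_prop
  have h := abs_sub_integral_velocity_le hbr hK' hρ hr (Real.sqrt_nonneg c)
    (Y := fun s : ℝ ↦ X (c ^ 2 * s).toNNReal / (c * √c))
    ((hcont.comp (continuous_const.mul continuous_id)).div_const _) (by simp [hX0])
    (fun s hs ↦ hasDerivAt_rescale hb hK hc hX hs) hsmall θ.coe_nonneg hθ
  have hθT : (c ^ 2 * (θ : ℝ)).toNNReal = θ * T := by
    rw [← hT, mul_comm, ← NNReal.coe_mul, Real.toNNReal_coe]
  simp only [hθT] at h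
  rw [hpow]
  exact h

/-- The rescaled particle is close in probability to the rescaled integrated velocity. -/
lemma tendsto_measure_rescaled (hB : IsTwoSidedBrownian B P) {X : ℝ≥0 → Ω → ℝ}
    (hX : IsPassiveParticle B X P) {V : Set (C(ℝ≥0, ℝ) × C(ℝ≥0, ℝ))}
    (hV : V ∈ uniformity C(ℝ≥0, ℝ)) :
    Tendsto (fun T : ℝ≥0 ↦ P.real {ω |
      (toPath (fun θ : ℝ≥0 ↦ X (θ * T) ω / (T : ℝ) ^ (3 / 4 : ℝ)),
        velocityPath (pathPair (fun x ω ↦ rescale (NNReal.sqrt T) (fun y ↦ B y ω) x) ω)) ∉ V})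
      (𝓝[>] 0) (𝓝 0) := by
  obtain ⟨S, U, hS, hU, hSU⟩ := (ContinuousMap.mem_compactConvergence_entourage_iff V).1 hV
  obtain ⟨δ, hδ, hδU⟩ := Metric.mem_uniformity_dist.1 hU
  obtain ⟨M, hM⟩ := hS.bddAbove
  set τ := timeConst M
  -- Order of choices: `ρ` from the tolerance `δ` and the horizon `M`, then `n` from the law of the
  -- environment, and finally `T` small in terms of both.
  obtain ⟨ρ, hρ, hρτ⟩ : ∃ ρ : ℝ, 0 < ρ ∧ ρ * τ < δ := by
    have hc : Tendsto (fun ρ ↦ ρ * τ) (𝓝[>] 0) (𝓝 0) := by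
      have : Continuous fun ρ : ℝ ↦ ρ * τ := by fun_prop
      simpa using (this.tendsto 0).mono_left nhdsWithin_le_nhds
    obtain ⟨ρ, h1, h2⟩ := ((hc.eventually_lt_const hδ).and self_mem_nhdsWithin).exists
    exact ⟨ρ, h2, h1⟩
  rw [Metric.tendsto_nhds]
  intro κ hκ
  obtain ⟨n, hn⟩ := exists_measure_tame_compl_lt hB hρ hκ
  have hsmall : ∀ᶠ T : ℝ≥0 in 𝓝[>] 0,
      √(NNReal.sqrt T : ℝ) * (((n : ℝ) + ρ) * τ) < 1 / ((n : ℝ) + 1) := by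
    have hc : Continuous fun T : ℝ≥0 ↦ √(NNReal.sqrt T : ℝ) * (((n : ℝ) + ρ) * τ) := by fun_prop
    have := (hc.tendsto 0).mono_left (nhdsWithin_le_nhds (s := Set.Ioi 0))
    refine this.eventually_lt_const ?_
    simp only [NNReal.sqrt_zero, NNReal.coe_zero, Real.sqrt_zero, zero_mul]
    positivity
  filter_upwards [hsmall, self_mem_nhdsWithin] with T hTs hT0
  have hT0 : 0 < T := hT0
  have hc0 : 0 < NNReal.sqrt T := NNReal.sqrt_pos.2 hT0
  have hTc : (T : ℝ) = (NNReal.sqrt T : ℝ) ^ 2 := by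
    rw [← NNReal.coe_pow, NNReal.sq_sqrt]
  have hB' := isTwoSidedBrownian_rescale hB hc0.ne'
  rw [dist_zero_right, Real.norm_of_nonneg measureReal_nonneg]
  refine lt_of_le_of_lt ?_ hn
  -- Scaling invariance turns the tame bound for `B` into one for the rescaled environment, with the
  -- same `n`.
  rw [map_pathPair_eq hB hB', map_measureReal_apply_of_aemeasurable (aemeasurable_pathPair hB')
    (measurableSet_tame _ _ _).compl]
  refine ENNReal.toReal_mono (measure_ne_top _ _) (measure_mono_ae ?_)
  filter_upwards [ae_regular hB, ae_glue_pathPair hB', ae_pathPair_mem_linearGrowth hB',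
    hX.initial, hX.continuous, hX.hasDerivAt] with ω ⟨hbc, K, hK⟩ hg hl hX0 hXc hXd hω
  by_contra htame
  obtain ⟨h1, h2⟩ := not_not.1 htame
  rw [hg] at h1 h2
  refine hω (hSU fun θ hθ ↦ hδU ?_)
  have hcont : Continuous fun θ : ℝ≥0 ↦ X (θ * T) ω / (T : ℝ) ^ (3 / 4 : ℝ) :=
    (hXc.comp (continuous_mul_const T)).div_const _
  rw [toPath_apply hcont, velocityPath_apply hl, hg, Real.dist_eq]
  exact (abs_rescaled_sub_le hbc hK hX0 hXc hXd hc0 hρ.le h1 h2 hTs hTc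
    (NNReal.coe_le_coe.2 (hM hθ))).trans_lt hρτ

end

end PassiveTracer

/-! ### Conclusion -/

theorem theorem2p2 {Ω : Type*} [MeasurableSpace Ω] (P : Measure Ω) [IsProbabilityMeasure P]
    (B : ℝ → Ω → ℝ) (hB : PassiveTracer.IsTwoSidedBrownian B P)
    (X : ℝ≥0 → Ω → ℝ) (hX : PassiveTracer.IsPassiveParticle B X P) :
    (∀ᵐ ω ∂P, ∀ θ : ℝ≥0, IntervalIntegrable
      (fun s : ℝ ↦ PassiveTracer.velocity (fun x ↦ B x ω) s 0) volume 0 θ) ∧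
    IsGaussianProcess
      (fun (θ : ℝ≥0) ω ↦ PassiveTracer.integratedVelocity (fun x ↦ B x ω) θ) P ∧
    TendstoInDistribution
      (fun (T : ℝ≥0) (ω : Ω) ↦
        PassiveTracer.toPath (fun θ : ℝ≥0 ↦ X (θ * T) ω / (T : ℝ) ^ (3 / 4 : ℝ)))
      (𝓝[>] (0 : ℝ≥0))
      (fun ω ↦ PassiveTracer.toPath
        (fun θ : ℝ≥0 ↦ PassiveTracer.integratedVelocity (fun x ↦ B x ω) θ))
      (fun _ ↦ P) P := by
  open PassiveTracer in
  refine ⟨?_, isGaussianProcess_integratedVelocity hB, ?_⟩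
  · filter_upwards [ae_regular hB] with ω ⟨hc, K, hK⟩ θ
    exact intervalIntegrable_velocity_zero hc hK θ.coe_nonneg
  · have hmeas := fun {A : ℝ → Ω → ℝ} (hA : IsTwoSidedBrownian A P) ↦
      measurable_velocityPath.comp_aemeasurable (aemeasurable_pathPair hA)
    have hW := ae_velocityPath_eq hB
    have hscale : ∀ᶠ T : ℝ≥0 in 𝓝[>] 0, IsTwoSidedBrownian
        (fun x ω ↦ rescale (NNReal.sqrt T) (fun y ↦ B y ω) x) P := by
      filter_upwards [self_mem_nhdsWithin] with T hT
      exact isTwoSidedBrownian_rescale hB (NNReal.sqrt_pos.2 hT).ne'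
    refine tendstoInDistribution_of_uniform (fun T ↦ ?_)
      (hscale.mono fun T hT ↦ hmeas hT) ((hmeas hB).congr hW) (hscale.mono fun T hT ↦ ?_)
      fun V hV ↦ tendsto_measure_rescaled hB hX hV
    -- Measurability is required for every `T`, including `T = 0`, where division by zero yields the
    -- zero path.
    · refine aemeasurable_toPath (fun θ ↦ (hX.aemeasurable (θ * T)).div_const _) ?_
      filter_upwards [hX.continuous] with ω hω
      exact (hω.comp (continuous_mul_const T)).div_const _
    · rw [← Measure.map_congr hW]
      refine (AEMeasurable.map_map_of_aemeasurable measurable_velocityPath.aemeasurable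
        (aemeasurable_pathPair hT)).symm.trans ?_
      rw [map_pathPair_eq hT hB]
      exact AEMeasurable.map_map_of_aemeasurable measurable_velocityPath.aemeasurable
        (aemeasurable_pathPair hB)
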